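/- Let $\mathbb K$ be a field of characteristic zero and $V$ a finite-dimensional $\mathbb Z$-graded vector space with homogeneous basis $(e_a)$. Let $t^a$ be the dual coordinates, $|t^a|=-|e_a|$, let $\psi_a$ be formal symbols with $|\psi_a|=1-|t^a|$, and let $\mathcal O_V=\mathbb K[[t^a]]$ and $\wedge^\bullet\mathcal T_V=\mathbb K[[t^a,\psi_a]]$ be the algebras of graded-commutative formal power series. The *weight* of a monomial is its number of factors $\psi_a$. Put $A\bullet B=\sum_a\frac{\partial A}{\partial\psi_a}\frac{\partial B}{\partial t^a}$ (right derivatives in $\psi_a$, left derivatives in $t^a$), let $$[A,B]=A\bullet B+(-1)^{|A||B|+|A|+|B|}B\bullet A$$ be the odd Schouten bracket, and let $[\cdot,\cdot]_{S_\hbar}$ be its $\hbar$-linear extension to $\wedge^\bullet\mathcal T_V[[\hbar]]$, where $|\hbar|=0$. Let $\mathfrak g_V$ be the set of all $\Gamma=\sum_{k\ge0}{}_k\Gamma\,\hbar^k\in\wedge^\bullet\mathcal T_V[[\hbar]]$ such that all terms of ${}_k\Gamma$ have weight at least $k+1$. Write the weight-$n$ part of ${}_k\Gamma$ as $${}_k\Gamma_n=\tfrac1{n!}\sum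 {}_k\Gamma^{a_1\dots a_n}(t)\,\psi_{a_1}\cdots\psi_{a_n}$$ with coefficients that have the graded symmetry of $\psi_{a_1}\cdots\psi_{a_n}$. For $1\le k\le n$ let the $n$-ary bracket ${}_kL_n:\mathcal O_V^{\otimes n}\to\mathcal O_V$ be the multilinear map given on homogeneous $f_1,\dots,f_n$ by $${}_kL_n(f_1,\dots,f_n)=(-1)^{\frac{(n-1)(n-2)}2}\sum_{a_1,\dots,a_n}(-1)^{\epsilon}\,{}_{k-1}\Gamma^{a_1\dots a_n}(t)\,(\partial_{a_1}f_1)\cdots(\partial_{a_n}f_n),\qquad \epsilon=\sum_{i=1}^n|t^{a_i}|\,(|f_1|+\dots+|f_{i-1}|+i-1),$$ where $\partial_a=\partial/\partial t^a$. An *$L^2_\infty$ algebra* structure on a graded vector space $W$ is a family of graded skew-symmetric multilinear maps ${}_kl_n:W^{\otimes n}\to W$ of degree $2-n$ ($n\ge1$, $1\le k\le n$) such that for all $n\ge 1$, all $2\le k\le n+1$ and all homogeneous $v_1,\dots,v_n$ $$\sum_{r+s=n+1}\ \sum_{\substack{i+j=k\\1\le i\le r,\ 1\le j\le s}}\ \sum_{\sigma}\epsilon(\sigma)\,\mathrm{sgn}(\sigma)\,(-1)^{r(s-1)}\,{}_il_r\big({}_jl_s(v_{\sigma(1)},\dots,v_{\sigma(s)}),v_{\sigma(s+1)},\dots,v_{\sigma(n)}\big)=0,$$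 where $\sigma$ runs over the $(s,n-s)$-unshuffles and $\epsilon(\sigma)$ is the Koszul sign; its differential is ${}_1l_1$. For $\mathcal O_V$ the conditions are imposed on homogeneous series, an element of degree $d$ being a series all of whose monomials have degree $d$. **Theorem.** Let $\Gamma\in\mathfrak g_V$ and $1\le k\le n$. (1) The bracket ${}_kL_n$ satisfies the Leibniz rule in each argument: for all homogeneous $f_1,\dots,f_{n-1},g,h\in\mathcal O_V$ and $1\le j\le n$, $${}_kL_n(f_1,\dots,f_{j-1},gh,f_j,\dots,f_{n-1})=(-1)^{|g|(|h|+|f_j|+\dots+|f_{n-1}|)}\,{}_kL_n(f_1,\dots,f_{j-1},h,f_j,\dots,f_{n-1})\,g+(-1)^{|h|(|f_j|+\dots+|f_{n-1}|)}\,{}_kL_n(f_1,\dots,f_{j-1},g,f_j,\dots,f_{n-1})\,h.$$ If $\Gamma$ is homogeneous of degree $D$, so that ${}_kL_n$ has degree $D-n$, then also $${}_kL_n(f_1,\dots,f_{j-1},gh,f_j,\dots,f_{n-1})=(-1)^{|g|(D-n+|f_1|+\dots+|f_{j-1}|)}\,g\,{}_kL_n(f_1,\dots,f_{j-1},h,f_j,\dots,f_{n-1})+(-1)^{|h|(|f_j|+\dots+|f_{n-1}|)}\,{}_kL_n(f_1,\dots,f_{j-1},g,f_j,\dots,f_{n-1})\,h.$$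 (2) The family $\{{}_kL_n\}_{n\ge1,\,1\le k\le n}$ gives $\mathcal O_V$ the structure of an $L^2_\infty$ algebra if and only if $\Gamma$ is homogeneous of degree two and $[\Gamma,\Gamma]_{S_\hbar}=0$. -/

import Mathlib

/-! ## Graded-commutative formal power series -/

/-- The Koszul sign `(-1)^n` as a scalar of `K`. -/
def koszul (K : Type*) [Field K] (n : ℤ) : K := ((n.negOnePow : ℤ) : K)

theorem koszul_add (K : Type*) [Field K] (m n : ℤ) :
    koszul K (m + n) = koszul K m * koszul K n := by
  simp [koszul, Int.negOnePow_add]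

theorem koszul_zero (K : Type*) [Field K] : koszul K 0 = 1 := by
  simp [koszul]

/-- Monomials in graded-commutative variables `x_j` of degree `deg j`, written in increasing order
of the variables: a variable of odd degree squares to zero, hence has exponent at most one. -/
abbrev GMon {J : Type*} (deg : J → ℤ) : Type _ :=
  {m : J →₀ ℕ // ∀ j, Odd (deg j) → m j ≤ 1}

/-- The space `K⟦x_j⟧` of formal power series in graded-commutative variables `x_j` of degree
`deg j`: a series is the family of its coefficients. -/
@[ext]
structure GSeries (K : Type*) {J : Type*} (deg : J → ℤ) where
  val : GMon deg → K

namespace GSeries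

/-- A series is determined by an arbitrary family of coefficients. -/
def equivFun (K : Type*) {J : Type*} (deg : J → ℤ) : GSeries K deg ≃ (GMon deg → K) where
  toFun := val
  invFun := mk
  left_inv _ := rfl
  right_inv _ := rfl

instance (K : Type*) [Field K] {J : Type*} (deg : J → ℤ) : AddCommGroup (GSeries K deg) :=
  (equivFun K deg).addCommGroup

instance (K : Type*) [Field K] {J : Type*} (deg : J → ℤ) : Module K (GSeries K deg) :=
  (equivFun K deg).module K

section

variable {K : Type*} [Field K] {J : Type*} {deg : J → ℤ}

theorem val_zero (m : GMon deg) : (0 : GSeries K deg).val m = 0 := rfl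

theorem val_add (f g : GSeries K deg) (m : GMon deg) : (f + g).val m = f.val m + g.val m := rfl

theorem val_smul (c : K) (f : GSeries K deg) (m : GMon deg) : (c • f).val m = c * f.val m := rfl

open Classical in
/-- The coefficient of an arbitrary exponent; it is zero if an odd variable is repeated. -/
noncomputable def coeff (m : J →₀ ℕ) : GSeries K deg →ₗ[K] K where
  toFun f := if h : ∀ j, Odd (deg j) → m j ≤ 1 then f.val ⟨m, h⟩ else 0
  map_add' f g := by split_ifs <;> simp [val_add]
  map_smul' c f := by split_ifs <;> simp [val_smul]

theorem coeff_val (f : GSeries K deg) (m : GMon deg) : coeff m.1 f = f.val m :=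
  dif_pos m.2

theorem ext_coeff {f g : GSeries K deg} (h : ∀ m : GMon deg, coeff m.1 f = coeff m.1 g) :
    f = g := by
  ext m
  rw [← coeff_val, ← coeff_val, h]

/-- The cohomological degree of a monomial. -/
def monDegree (deg : J → ℤ) (m : J →₀ ℕ) : ℤ := m.sum fun j k => (k : ℤ) * deg j

/-- The subspace of homogeneous series of degree `d`. -/
def homog (K : Type*) [Field K] {J : Type*} (deg : J → ℤ) (d : ℤ) :
    Submodule K (GSeries K deg) where
  carrier := {f | ∀ m : GMon deg, monDegree deg m.1 ≠ d → f.val m = 0}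
  zero_mem' := fun m _ => val_zero m
  add_mem' := fun hf hg m hm => by rw [val_add, hf m hm, hg m hm, add_zero]
  smul_mem' := fun c f hf m hm => by rw [val_smul, hf m hm, mul_zero]

/-- The part of a series that consists of its terms of parity `p`. -/
noncomputable def parityPart (p : ZMod 2) : GSeries K deg →ₗ[K] GSeries K deg where
  toFun f := ⟨fun m => if ((monDegree deg m.1 : ℤ) : ZMod 2) = p then f.val m else 0⟩
  map_add' f g := by
    ext m
    simp only [val_add]
    split_ifs <;> simp
  map_smul' c f := by
    ext m
    simp only [val_smul, RingHom.id_apply]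
    split_ifs <;> simp

end

section

variable {K : Type*} [Field K] {J : Type*} [Fintype J] [LinearOrder J] {deg : J → ℤ}

/-- The exponent of the sign that arises when the product `x^u x^v` of two ordered monomials is
put in increasing order: each `x_i` of `x^u` passes each `x_j` of `x^v` with `j < i`. -/
def crossing (deg : J → ℤ) (u v : J →₀ ℕ) : ℤ :=
  ∑ i, ∑ j with j < i, (u i * deg i) * (v j * deg j)

theorem crossing_add_left (u u' v : J →₀ ℕ) :
    crossing deg (u + u') v = crossing deg u v + crossing deg u' v := by
  simp only [crossing, ← Finset.sum_add_distrib]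
  refine Finset.sum_congr rfl fun i _ => Finset.sum_congr rfl fun j _ => ?_
  simp only [Finsupp.add_apply]
  push_cast
  ring

theorem crossing_add_right (u v v' : J →₀ ℕ) :
    crossing deg u (v + v') = crossing deg u v + crossing deg u v' := by
  simp only [crossing, ← Finset.sum_add_distrib]
  refine Finset.sum_congr rfl fun i _ => Finset.sum_congr rfl fun j _ => ?_
  simp only [Finsupp.add_apply]
  push_cast
  ring

theorem crossing_zero_left (v : J →₀ ℕ) : crossing deg 0 v = 0 := by simp [crossing]

theorem crossing_zero_right (u : J →₀ ℕ) : crossing deg u 0 = 0 := by simp [crossing]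

/-- The graded-commutative product of series. -/
noncomputable instance : Mul (GSeries K deg) where
  mul f g := ⟨fun m => ∑ p ∈ Finset.HasAntidiagonal.antidiagonal m.1,
    koszul K (crossing deg p.1 p.2) * (coeff p.1 f * coeff p.2 g)⟩

noncomputable instance : One (GSeries K deg) where
  one := ⟨fun m => if m.1 = 0 then 1 else 0⟩

theorem coeff_mul (f g : GSeries K deg) (m : J →₀ ℕ) (hm : ∀ j, Odd (deg j) → m j ≤ 1) :
    coeff m (f * g) = ∑ p ∈ Finset.HasAntidiagonal.antidiagonal m,
      koszul K (crossing deg p.1 p.2) * (coeff p.1 f * coeff p.2 g) :=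
  coeff_val (f * g) ⟨m, hm⟩

theorem coeff_one (m : J →₀ ℕ) : coeff m (1 : GSeries K deg) = if m = 0 then 1 else 0 := by
  by_cases hm : ∀ j, Odd (deg j) → m j ≤ 1
  · exact coeff_val 1 ⟨m, hm⟩
  · have h0 : m ≠ 0 := by
      rintro rfl
      exact hm fun _ _ => Nat.zero_le _
    rw [if_neg h0]
    exact dif_neg hm

theorem adm_of_antidiagonal {J : Type*} [LinearOrder J] {deg : J → ℤ} {m : J →₀ ℕ}
    (hm : ∀ j, Odd (deg j) → m j ≤ 1)
    {p : (J →₀ ℕ) × (J →₀ ℕ)} (hp : p ∈ Finset.HasAntidiagonal.antidiagonal m) :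
    (∀ j, Odd (deg j) → p.1 j ≤ 1) ∧ (∀ j, Odd (deg j) → p.2 j ≤ 1) := by
  rw [Finset.HasAntidiagonal.mem_antidiagonal] at hp
  subst hp
  constructor <;> intro j hj <;> have := hm j hj <;> rw [Finsupp.add_apply] at this <;> omega

theorem mul_assoc' (f g h : GSeries K deg) : f * g * h = f * (g * h) := by
  refine ext_coeff fun m => ?_
  obtain ⟨m, hm⟩ := m
  have h1 : coeff m (f * g * h) = ∑ p ∈ Finset.HasAntidiagonal.antidiagonal m,
      ∑ q ∈ Finset.HasAntidiagonal.antidiagonal p.1, koszul K (crossing deg (q.1 + q.2) p.2) *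
        (koszul K (crossing deg q.1 q.2) * (coeff q.1 f * coeff q.2 g) * coeff p.2 h) := by
    rw [coeff_mul _ _ _ hm]
    refine Finset.sum_congr rfl fun p hp => ?_
    rw [coeff_mul _ _ _ (adm_of_antidiagonal hm hp).1, Finset.sum_mul, Finset.mul_sum]
    refine Finset.sum_congr rfl fun q hq => ?_
    rw [Finset.HasAntidiagonal.mem_antidiagonal.1 hq]
  have h2 : coeff m (f * (g * h)) = ∑ p ∈ Finset.HasAntidiagonal.antidiagonal m,
      ∑ q ∈ Finset.HasAntidiagonal.antidiagonal p.2, koszul K (crossing deg p.1 (q.1 + q.2)) *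
        (coeff p.1 f * (koszul K (crossing deg q.1 q.2) * (coeff q.1 g * coeff q.2 h))) := by
    rw [coeff_mul _ _ _ hm]
    refine Finset.sum_congr rfl fun p hp => ?_
    rw [coeff_mul _ _ _ (adm_of_antidiagonal hm hp).2, Finset.mul_sum, Finset.mul_sum]
    refine Finset.sum_congr rfl fun q hq => ?_
    rw [Finset.HasAntidiagonal.mem_antidiagonal.1 hq]
  rw [h1, h2, Finset.sum_sigma', Finset.sum_sigma']
  refine Finset.sum_nbij' (fun x => ⟨(x.2.1, x.2.2 + x.1.2), (x.2.2, x.1.2)⟩)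
    (fun x => ⟨(x.1.1 + x.2.1, x.2.2), (x.1.1, x.2.1)⟩) ?_ ?_ ?_ ?_ ?_
  · rintro ⟨⟨a, b⟩, ⟨c, d⟩⟩ hx
    simp only [Finset.mem_sigma, Finset.HasAntidiagonal.mem_antidiagonal] at hx ⊢
    obtain ⟨rfl, rfl⟩ := hx
    exact ⟨(add_assoc _ _ _).symm, trivial⟩
  · rintro ⟨⟨a, b⟩, ⟨c, d⟩⟩ hx
    simp only [Finset.mem_sigma, Finset.HasAntidiagonal.mem_antidiagonal] at hx ⊢
    obtain ⟨rfl, rfl⟩ := hx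
    exact ⟨add_assoc _ _ _, trivial⟩
  · rintro ⟨⟨a, b⟩, ⟨c, d⟩⟩ hx
    simp only [Finset.mem_sigma, Finset.HasAntidiagonal.mem_antidiagonal] at hx
    obtain ⟨rfl, rfl⟩ := hx
    rfl
  · rintro ⟨⟨a, b⟩, ⟨c, d⟩⟩ hx
    simp only [Finset.mem_sigma, Finset.HasAntidiagonal.mem_antidiagonal] at hx
    obtain ⟨rfl, rfl⟩ := hx
    rfl
  · rintro ⟨⟨a, b⟩, ⟨c, d⟩⟩ hx
    simp only [crossing_add_left, crossing_add_right, koszul_add]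
    ring

theorem one_mul' (f : GSeries K deg) : 1 * f = f := by
  refine ext_coeff fun m => ?_
  rw [coeff_mul _ _ _ m.2, Finset.sum_eq_single (0, m.1)]
  · simp [coeff_one, crossing_zero_left, koszul_zero]
  · rintro ⟨a, b⟩ hp hne
    have ha : a ≠ 0 := by
      rintro rfl
      rw [Finset.HasAntidiagonal.mem_antidiagonal, zero_add] at hp
      exact hne (Prod.ext rfl hp)
    simp [coeff_one, ha]
  · intro h
    exact absurd (Finset.HasAntidiagonal.mem_antidiagonal.2 (zero_add _)) h

theorem mul_one' (f : GSeries K deg) : f * 1 = f := by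
  refine ext_coeff fun m => ?_
  rw [coeff_mul _ _ _ m.2, Finset.sum_eq_single (m.1, 0)]
  · simp [coeff_one, crossing_zero_right, koszul_zero]
  · rintro ⟨a, b⟩ hp hne
    have hb : b ≠ 0 := by
      rintro rfl
      rw [Finset.HasAntidiagonal.mem_antidiagonal, add_zero] at hp
      exact hne (Prod.ext hp rfl)
    simp [coeff_one, hb]
  · intro h
    exact absurd (Finset.HasAntidiagonal.mem_antidiagonal.2 (add_zero _)) h

theorem mul_add' (f g h : GSeries K deg) : f * (g + h) = f * g + f * h := by
  refine ext_coeff fun m => ?_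
  rw [map_add, coeff_mul _ _ _ m.2, coeff_mul _ _ _ m.2, coeff_mul _ _ _ m.2,
    ← Finset.sum_add_distrib]
  refine Finset.sum_congr rfl fun p _ => ?_
  rw [map_add]
  ring

theorem add_mul' (f g h : GSeries K deg) : (f + g) * h = f * h + g * h := by
  refine ext_coeff fun m => ?_
  rw [map_add, coeff_mul _ _ _ m.2, coeff_mul _ _ _ m.2, coeff_mul _ _ _ m.2,
    ← Finset.sum_add_distrib]
  refine Finset.sum_congr rfl fun p _ => ?_
  rw [map_add]
  ring

theorem smul_mul' (c : K) (f g : GSeries K deg) : (c • f) * g = c • (f * g) := by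
  refine ext_coeff fun m => ?_
  rw [map_smul, coeff_mul _ _ _ m.2, coeff_mul _ _ _ m.2, Finset.smul_sum]
  refine Finset.sum_congr rfl fun p _ => ?_
  rw [map_smul, smul_eq_mul, smul_eq_mul]
  ring

theorem mul_smul' (c : K) (f g : GSeries K deg) : f * (c • g) = c • (f * g) := by
  refine ext_coeff fun m => ?_
  rw [map_smul, coeff_mul _ _ _ m.2, coeff_mul _ _ _ m.2, Finset.smul_sum]
  refine Finset.sum_congr rfl fun p _ => ?_
  rw [map_smul, smul_eq_mul, smul_eq_mul]
  ring

noncomputable instance : Ring (GSeries K deg) :=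
  { (inferInstance : AddCommGroup (GSeries K deg)),
    (inferInstance : Mul (GSeries K deg)),
    (inferInstance : One (GSeries K deg)) with
    mul_assoc := mul_assoc'
    one_mul := one_mul'
    mul_one := mul_one'
    left_distrib := mul_add'
    right_distrib := add_mul'
    zero_mul := fun f => by
      have h := smul_mul' (0 : K) f f
      rwa [zero_smul, zero_smul] at h
    mul_zero := fun f => by
      have h := mul_smul' (0 : K) f f
      rwa [zero_smul, zero_smul] at h }

noncomputable instance : Algebra K (GSeries K deg) :=
  Algebra.ofModule smul_mul' mul_smul'

/-- The left partial derivative `∂/∂x_j`, in which `x_j` is first moved to the left end of each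
monomial. -/
noncomputable def leftDeriv (j : J) : GSeries K deg →ₗ[K] GSeries K deg where
  toFun f := ⟨fun m => koszul K (deg j * ∑ i with i < j, m.1 i * deg i) *
    ((m.1 j + 1 : K) * coeff (m.1 + Finsupp.single j 1) f)⟩
  map_add' f g := by
    ext m
    simp only [val_add, map_add]
    ring
  map_smul' c f := by
    ext m
    simp only [val_smul, map_smul, smul_eq_mul, RingHom.id_apply]
    ring

/-- The right partial derivative `∂/∂x_j`, in which `x_j` is first moved to the right end of each
monomial. -/
noncomputable def rightDeriv (j : J) : GSeries K deg →ₗ[K] GSeries K deg where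
  toFun f := ⟨fun m => koszul K (deg j * ∑ i with j < i, m.1 i * deg i) *
    ((m.1 j + 1 : K) * coeff (m.1 + Finsupp.single j 1) f)⟩
  map_add' f g := by
    ext m
    simp only [val_add, map_add]
    ring
  map_smul' c f := by
    ext m
    simp only [val_smul, map_smul, smul_eq_mul, RingHom.id_apply]
    ring

end

end GSeries

/-! ## The formal graded manifold of a graded vector space

`V` is a finite-dimensional `ℤ`-graded vector space with a homogeneous basis `e_a`, `a : ι`, and
`δ a` is the degree of `e_a`. -/

/-- The degree `|t^a| = -|e_a|` of the coordinates dual to the basis `e_a`. -/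
def coordDeg {ι : Type*} (δ : ι → ℤ) : ι → ℤ := fun a => -δ a

/-- The degrees of the generators of the polyvector fields: `|t^a| = -|e_a|` for `inl a` and
`|ψ_a| = 1 - |t^a|` for `inr a`. -/
def polyDeg {ι : Type*} (δ : ι → ℤ) : ι ⊕ₗ ι → ℤ := fun x =>
  Sum.elim (fun a => coordDeg δ a) (fun a => 1 - coordDeg δ a) (ofLex x)

/-- The structure sheaf `O_V = K⟦t^a⟧`. Its homogeneous elements of degree `d` are the series all
of whose monomials have degree `d`, see `GSeries.homog`. -/
abbrev FunctionAlg (K : Type*) {ι : Type*} (δ : ι → ℤ) : Type _ := GSeries K (coordDeg δ)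

/-- The polyvector fields `⋀ T_V = K⟦t^a, ψ_a⟧`. -/
abbrev PolyVec (K : Type*) {ι : Type*} (δ : ι → ℤ) : Type _ := GSeries K (polyDeg δ)

section

variable {K : Type*} [Field K] {ι : Type*} [Fintype ι] [LinearOrder ι] {δ : ι → ℤ}

/-- The weight of a monomial, its number of factors `ψ_a`. -/
def weight (m : ι ⊕ₗ ι →₀ ℕ) : ℕ := ∑ a : ι, m (Sum.inrₗ a)

/-- `A • B = ∑ (∂A/∂ψ_a) (∂B/∂t^a)`, with right derivatives in `ψ_a` and left derivatives in
`t^a`. -/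
noncomputable def bullet (A B : PolyVec K δ) : PolyVec K δ :=
  ∑ a : ι, GSeries.rightDeriv (Sum.inrₗ a) A * GSeries.leftDeriv (Sum.inlₗ a) B

/-- The odd Schouten bracket: the biadditive extension of
`[A, B] = A • B + (-1)^(|A||B| + |A| + |B|) B • A`. -/
noncomputable def schouten (A B : PolyVec K δ) : PolyVec K δ :=
  ∑ p : ZMod 2, ∑ q : ZMod 2,
    (bullet (GSeries.parityPart p A) (GSeries.parityPart q B) +
      koszul K (p.val * q.val + p.val + q.val) •
        bullet (GSeries.parityPart q B) (GSeries.parityPart p A))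

/-- The extension of the odd Schouten bracket to `⋀ T_V⟦ħ⟧` that is linear in `ħ`. -/
noncomputable def schoutenHbar (A B : PowerSeries (PolyVec K δ)) : PowerSeries (PolyVec K δ) :=
  PowerSeries.mk fun k => ∑ p ∈ Finset.HasAntidiagonal.antidiagonal k,
    schouten (PowerSeries.coeff p.1 A) (PowerSeries.coeff p.2 B)

/-- `g_V`: the elements `∑ Γ_k ħ^k` of `⋀ T_V⟦ħ⟧` such that all terms of `Γ_k` have weight at least
`k + 1`. -/
def gV (K : Type*) [Field K] {ι : Type*} [Fintype ι] [LinearOrder ι] (δ : ι → ℤ) :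
    Set (PowerSeries (PolyVec K δ)) :=
  {Γ | ∀ (k : ℕ) (m : GMon (polyDeg δ)), weight m.1 < k + 1 → (PowerSeries.coeff k Γ).val m = 0}

/-- `Γ` is homogeneous of degree `d`; the parameter `ħ` has degree zero. -/
def HasDegree (Γ : PowerSeries (PolyVec K δ)) (d : ℤ) : Prop :=
  ∀ k, PowerSeries.coeff k Γ ∈ GSeries.homog K (polyDeg δ) d

/-- The restriction of a polyvector field to `ψ = 0`. -/
noncomputable def setPsiZero (A : PolyVec K δ) : FunctionAlg K δ :=
  ⟨fun m => GSeries.coeff (Finsupp.mapDomain (fun a => (Sum.inlₗ a : ι ⊕ₗ ι)) m.1) A⟩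

/-- The coefficients `A^{a_1 … a_n}(t)` of a polyvector field, normalized by
`A = ∑_n 1/n! ∑ A^{a_1 … a_n}(t) ψ_{a_1} ⋯ ψ_{a_n}` and graded symmetric in the `ψ_a`. They are
obtained by splitting off `ψ_{a_n}`, …, `ψ_{a_1}` successively on the right. -/
noncomputable def polyCoeff (A : PolyVec K δ) {n : ℕ} (a : Fin n → ι) : FunctionAlg K δ :=
  setPsiZero ((List.ofFn a).foldr (fun b X => GSeries.rightDeriv (Sum.inrₗ b) X) A)

/-- The exponent `ε = ∑_i |∂_{a_i}| (|f_1| + ⋯ + |f_{i-1}| + i - 1)`, where `p j` is the parity of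
`f_j` and `|∂_a|` has the parity of `|t^a|`. -/
def bracketSign (δ : ι → ℤ) {n : ℕ} (a : Fin n → ι) (p : Fin n → ZMod 2) : ℤ :=
  ∑ i : Fin n, coordDeg δ (a i) * ((∑ j with j < i, ((p j).val : ℤ)) + (i : ℕ))

/-- The bracket `_kL_n` of `Γ` for `1 ≤ k ≤ n`: the multilinear map that is given on homogeneous
functions by
`(-1)^((n-1)(n-2)/2 + ε) ∑ Γ_{k-1}^{a_1 … a_n}(t) (∂_{a_1} f_1) ⋯ (∂_{a_n} f_n)`.
The sign `(-1)^((n-1)(n-2)/2)`, which is trivial for `n ≤ 2`, matches the bracket to the sign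
`(-1)^(r(s-1))` of the relations of an `L_∞` algebra. -/
noncomputable def bracket (Γ : PowerSeries (PolyVec K δ)) (k n : ℕ) :
    MultilinearMap K (fun _ : Fin n => FunctionAlg K δ) (FunctionAlg K δ) :=
  koszul K ((n - 1).choose 2) • ∑ a : Fin n → ι, ∑ p : Fin n → ZMod 2,
    koszul K (bracketSign δ a p) •
      (LinearMap.mulLeft K (polyCoeff (PowerSeries.coeff (k - 1) Γ) a)).compMultilinearMap
        ((MultilinearMap.mkPiAlgebraFin K n (FunctionAlg K δ)).compLinearMap fun i =>
          GSeries.leftDeriv (a i) ∘ₗ GSeries.parityPart (p i))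

end

/-! ## `L²_∞` algebras -/

/-- The Koszul sign exponent of `v_1 ⋯ v_n ↦ v_{σ(1)} ⋯ v_{σ(n)}` for `v_i` of degree `d i`. -/
def permKoszul {n : ℕ} (d : Fin n → ℤ) (σ : Equiv.Perm (Fin n)) : ℤ :=
  ∑ i, ∑ j with i < j ∧ σ j < σ i, d (σ i) * d (σ j)

/-- `σ` is an `(s, n - s)`-unshuffle: it increases on the first `s` and on the last `n - s`
places. -/
def IsUnshuffle {n : ℕ} (s : ℕ) (σ : Equiv.Perm (Fin n)) : Prop :=
  ∀ i j : Fin n, i < j → ((j : ℕ) < s ∨ s ≤ (i : ℕ)) → σ i < σ j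

open Classical in
/-- The left side of the `(n, k)`-th relation of an `L²_∞` algebra,
`∑ ε(σ) sgn(σ) (-1)^(r(s-1)) _il_r(_jl_s(v_{σ(1)}, …, v_{σ(s)}), v_{σ(s+1)}, …, v_{σ(n)})`,
over `r + s = n + 1`, `i + j = k`, `1 ≤ i ≤ r`, `1 ≤ j ≤ s` and all `(s, n - s)`-unshuffles `σ`.
The inner arity is `s = x + 1` and the outer arity is `r = (n - 1 - x) + 1 = n - x`, for
`x : Fin n`. -/
noncomputable def l2InftyRelation {K W : Type*} [Field K] [AddCommGroup W] [Module K W]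
    (l : ∀ _ n : ℕ, MultilinearMap K (fun _ : Fin n => W) W) (n k : ℕ)
    (d : Fin n → ℤ) (v : Fin n → W) : W :=
  ∑ x : Fin n, ∑ ij ∈ Finset.HasAntidiagonal.antidiagonal k with
      (1 ≤ ij.1 ∧ ij.1 ≤ n - (x : ℕ)) ∧ (1 ≤ ij.2 ∧ ij.2 ≤ (x : ℕ) + 1),
    ∑ σ : Equiv.Perm (Fin n) with IsUnshuffle ((x : ℕ) + 1) σ,
      koszul K (permKoszul d σ + ((n : ℤ) - x) * x) •
        ((Equiv.Perm.sign σ : ℤ) : K) •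
          l ij.1 (n - 1 - x + 1) (Fin.cons
            (l ij.2 (x + 1) fun y : Fin (x + 1) => v (σ ⟨y, by omega⟩))
            (fun y : Fin (n - 1 - x) => v (σ ⟨x + 1 + y, by omega⟩)))

/-- The maps `_kl_n`, `1 ≤ k ≤ n`, form an `L²_∞` algebra on `W`, whose homogeneous elements of
degree `d` are those of `H d`: they are multilinear of degree `2 - n`, graded skew-symmetric, and
satisfy all the relations. The differential of `W` is `_1l_1`. -/
structure IsL2InftyAlgebra {K W : Type*} [Field K] [AddCommGroup W] [Module K W]
    (H : ℤ → Submodule K W) (l : ∀ _ n : ℕ, MultilinearMap K (fun _ : Fin n => W) W) : Prop where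
  degree : ∀ k n : ℕ, 1 ≤ k → k ≤ n → ∀ (d : Fin n → ℤ) (v : Fin n → W),
    (∀ i, v i ∈ H (d i)) → l k n v ∈ H ((∑ i, d i) + 2 - n)
  skew : ∀ k n : ℕ, 1 ≤ k → k ≤ n → ∀ (d : Fin n → ℤ) (v : Fin n → W),
    (∀ i, v i ∈ H (d i)) → ∀ σ : Equiv.Perm (Fin n),
      l k n (fun i => v (σ i)) =
        koszul K (permKoszul d σ) • ((Equiv.Perm.sign σ : ℤ) : K) • l k n v
  relation : ∀ n k : ℕ, 2 ≤ k → k ≤ n + 1 → ∀ (d : Fin n → ℤ) (v : Fin n → W),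
    (∀ i, v i ∈ H (d i)) → l2InftyRelation l n k d v = 0

/-! ## Derived brackets

For a function `f` the operator `A ↦ A • f` is the Schouten bracket `[A, f]`, because `f` does not
depend on `ψ`. Iterating it and putting `ψ = 0` gives the derived brackets
`E_A(f_1, …, f_n) = ((⋯ (A • f_n) • ⋯) • f_1)|_{ψ = 0}`, and a comparison of signs shows that the
bracket `_kL_n` of a homogeneous `Γ` is `E_A`, for `A` the coefficient of `ħ^(k-1)`, up to the sign
`(-1)^((n-1)(n-2)/2 + ∑_{i<j} (1+|f_i|)|f_j|)` (`bracket_eq_iterBullet`).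

The decisive identity is the Jacobi identity `homogBracket_bullet`: bracketing with a function is a
graded derivation of the Schouten bracket. For `•` itself this fails by a term containing second
derivatives of the function (`bullet_bullet`), which is graded antisymmetric and hence disappears
from the bracket (`secondOrder_symm`). Consequently the iterated bracket of `[A, B]` with
`f_1, …, f_n` is a signed sum, over all splittings of the arguments, of the Schouten brackets of the
iterated brackets of `A` with the `f_J` and of `B` with the `f_I` (`iterBullet_homogBracket`). At
`ψ = 0` the product `X • Y` depends on `Y` only through `Y|_{ψ = 0}`, so this sum consists of the
compositions `E_A(E_B(f_I), f_J)` and `E_B(E_A(f_I), f_J)` (`setPsiZero_iterBullet_homogBracket`).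
Splittings are unshuffles (`sum_isUnshuffle`), and the signs turn into those of an `L_∞` algebra
(`relation_sign`). With `A` and `B` running through the coefficients of `Γ`, the derived brackets of
`[Γ, Γ]` are therefore twice the left sides of the relations (`setPsiZero_iterBullet_schoutenHbar`);
the condition on the weights of `Γ` removes the terms with `i > r` or `j > s` or without inner
arguments.

Graded skew-symmetry holds because the operators `• f` graded-commute (`bullet_incl_comm`), and the
Leibniz rule because every `∂_a` is a derivation. For the converse one evaluates on the coordinates
`t^a`: the bracket of `t^{a_1}, …, t^{a_n}` is the coefficient `Γ^{a_1 … a_n}` up to sign, and in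
characteristic zero these coefficients determine a polyvector field (`exists_coeff_polyCoeff`). -/

/-! ### Signs -/

section Signs

variable (K : Type*) [Field K]

/-- Equality of signs is equality of the exponents modulo two. The sign identities below are thereby
reduced to polynomial identities over `ZMod 2`. -/
theorem koszul_congr {m n : ℤ} (h : (m : ZMod 2) = n) : koszul K m = koszul K n := by
  have h1 := (ZMod.intCast_eq_intCast_iff_dvd_sub m n 2).1 h
  have h2 : Even (n - m) := even_iff_two_dvd.2 (by exact_mod_cast h1)
  rw [koszul, koszul, (Int.negOnePow_eq_iff n m).2 h2]

theorem koszul_mul_self (n : ℤ) : koszul K n * koszul K n = 1 := by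
  rw [← koszul_add, ← koszul_zero K]
  refine koszul_congr K ?_
  push_cast
  generalize (n : ZMod 2) = x
  revert x
  decide

theorem koszul_ne_zero (n : ℤ) : koszul K n ≠ 0 := fun h => by
  simpa [h] using koszul_mul_self K n

theorem koszul_one : koszul K 1 = -1 := by simp [koszul]

theorem koszul_of_even {n : ℤ} (h : Even n) : koszul K n = 1 := by
  simp [koszul, Int.negOnePow_even n h]

theorem koszul_of_odd {n : ℤ} (h : Odd n) : koszul K n = -1 := by
  simp [koszul, Int.negOnePow_odd n h]

theorem koszul_smul_smul {M : Type*} [AddCommGroup M] [Module K M] (m n : ℤ) (x : M) :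
    koszul K m • koszul K n • x = koszul K (m + n) • x := by
  rw [smul_smul, koszul_add]

/-- The factor by which `∂/∂x` acts on `x^a` for a variable `x` of degree `e`, as an element of `K`
that makes sense for every `a`: it is `a` if `x` is even and the residue of `a` modulo two if `x` is
odd. -/
def superNat (e : ℤ) (a : ℕ) : K :=
  open Classical in if Odd e then (if Odd a then 1 else 0) else a

theorem superNat_zero (e : ℤ) : superNat K e 0 = 0 := by simp [superNat]

theorem superNat_add (e : ℤ) (a b : ℕ) :
    superNat K e (a + b) = superNat K e a + koszul K (a * e) * superNat K e b := by
  by_cases he : Odd e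
  · have hk : koszul K (a * e) = if Odd a then -1 else 1 := by
      split_ifs with ha
      · exact koszul_of_odd K (Int.odd_mul.2 ⟨by exact_mod_cast ha, he⟩)
      · exact koszul_of_even K (Int.even_mul.2 (Or.inl (by
          exact_mod_cast Nat.not_odd_iff_even.1 ha)))
    rw [hk]
    simp only [superNat, he, if_true, Nat.odd_add']
    by_cases ha : Odd a <;> by_cases hb : Odd b <;>
      simp [ha, hb, Nat.not_even_iff_odd, Nat.not_odd_iff_even.1]
  · have hk : koszul K (a * e) = 1 :=
      koszul_of_even K (Int.even_mul.2 (Or.inr (Int.not_odd_iff_even.1 he)))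
    simp [superNat, he, hk]

end Signs

/-! ### Derivatives and products of graded-commutative series -/

namespace GSeries

open Finset.HasAntidiagonal (antidiagonal mem_antidiagonal)

section

variable {K : Type*} [Field K] {J : Type*} {deg : J → ℤ}

theorem coeff_of_not_adm {m : J →₀ ℕ} (hm : ¬ ∀ j, Odd (deg j) → m j ≤ 1) (f : GSeries K deg) :
    coeff m f = 0 := dif_neg hm

theorem monDegree_add (u v : J →₀ ℕ) : monDegree deg (u + v) = monDegree deg u + monDegree deg v :=
  Finsupp.sum_add_index' (by simp) (by intros; push_cast; ring)

theorem monDegree_single (j : J) : monDegree deg (Finsupp.single j (1 : ℕ)) = deg j := by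
  simp [monDegree]

theorem monDegree_zero : monDegree deg 0 = 0 := by simp [monDegree]

theorem monDegree_eq_sum [Fintype J] (m : J →₀ ℕ) : monDegree deg m = ∑ j, (m j : ℤ) * deg j :=
  Finsupp.sum_fintype _ _ (by simp)

theorem coeff_eq_zero_of_mem_homog {f : GSeries K deg} {d : ℤ} (hf : f ∈ homog K deg d)
    {m : J →₀ ℕ} (hm : monDegree deg m ≠ d) : coeff m f = 0 := by
  by_cases h : ∀ j, Odd (deg j) → m j ≤ 1
  · rw [← hf ⟨m, h⟩ hm]
    exact coeff_val f ⟨m, h⟩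
  · exact coeff_of_not_adm h f

theorem mem_homog_iff {f : GSeries K deg} {d : ℤ} :
    f ∈ homog K deg d ↔ ∀ m : J →₀ ℕ, monDegree deg m ≠ d → coeff m f = 0 :=
  ⟨fun hf _ hm => coeff_eq_zero_of_mem_homog hf hm,
    fun h m hm => by rw [← coeff_val]; exact h m.1 hm⟩

/-- The factor `m_j + 1` in the partial derivatives may be replaced by its superinteger: they differ
only where `x_j` is odd and occurs in `m`, and then `x_j m` is zero. -/
theorem superNat_mul_coeff (j : J) (f : GSeries K deg) (m : J →₀ ℕ) :
    superNat K (deg j) (m j + 1) * coeff (m + Finsupp.single j (1 : ℕ)) f =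
      (m j + 1 : K) * coeff (m + Finsupp.single j (1 : ℕ)) f := by
  by_cases hj : Odd (deg j)
  · by_cases h0 : m j = 0
    · simp [superNat, h0, hj]
    · rw [coeff_of_not_adm, mul_zero, mul_zero]
      intro h
      have := h j hj
      simp only [Finsupp.add_apply, Finsupp.single_eq_same] at this
      omega
  · simp [superNat, hj]

/-- Reindexing of the terms of a product in which the derived variable sits in the first factor. -/
theorem sum_antidiagonal_add_single_left {M : Type*} [AddCommMonoid M] [DecidableEq J]
    (m : J →₀ ℕ) (j : J)
    (F : (J →₀ ℕ) × (J →₀ ℕ) → M) (hF : ∀ p q : J →₀ ℕ, p j = 0 → F (p, q) = 0) :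
    ∑ x ∈ antidiagonal (m + Finsupp.single j (1 : ℕ)), F x =
      ∑ x ∈ antidiagonal m, F (x.1 + Finsupp.single j (1 : ℕ), x.2) := by
  symm
  refine Finset.sum_of_injOn (fun x => (x.1 + Finsupp.single j (1 : ℕ), x.2)) ?_ ?_ ?_ ?_
  · rintro ⟨a, b⟩ _ ⟨c, d⟩ _ h
    simpa using h
  · rintro ⟨a, b⟩ h
    simp only [Finset.mem_coe, mem_antidiagonal] at h ⊢
    rw [← h]
    abel
  · rintro ⟨a, b⟩ h h'
    refine hF a b (by_contra fun ha => h' ?_)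
    rw [mem_antidiagonal] at h
    have ha' : Finsupp.single j (1 : ℕ) ≤ a := by
      rw [Finsupp.single_le_iff]
      omega
    refine ⟨(a - Finsupp.single j (1 : ℕ), b), ?_, ?_⟩
    · simp only [Finset.mem_coe, mem_antidiagonal]
      refine add_right_cancel (b := Finsupp.single j (1 : ℕ)) ?_
      rw [← h, add_right_comm, tsub_add_cancel_of_le ha']
    · simp [tsub_add_cancel_of_le ha']
  · intros
    rfl

theorem sum_antidiagonal_add_single_right {M : Type*} [AddCommMonoid M] [DecidableEq J]
    (m : J →₀ ℕ) (j : J)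
    (F : (J →₀ ℕ) × (J →₀ ℕ) → M) (hF : ∀ p q : J →₀ ℕ, q j = 0 → F (p, q) = 0) :
    ∑ x ∈ antidiagonal (m + Finsupp.single j (1 : ℕ)), F x =
      ∑ x ∈ antidiagonal m, F (x.1, x.2 + Finsupp.single j (1 : ℕ)) := by
  have h1 := Finsupp.sum_antidiagonal_swap (m + Finsupp.single j (1 : ℕ)) fun a b => F (a, b)
  have h2 := Finsupp.sum_antidiagonal_swap m fun a b => F (a, b + Finsupp.single j (1 : ℕ))
  exact h1.trans ((sum_antidiagonal_add_single_left m j (fun x => F x.swap)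
    fun p q h => hF q p h).trans h2.symm)

end

section

variable {K : Type*} [Field K] {J : Type*} [Fintype J] [LinearOrder J] {deg : J → ℤ}

theorem coeff_leftDeriv (j : J) (f : GSeries K deg) (m : J →₀ ℕ) :
    coeff m (leftDeriv j f) = koszul K (deg j * ∑ i with i < j, m i * deg i) *
      ((m j + 1 : K) * coeff (m + Finsupp.single j (1 : ℕ)) f) := by
  by_cases hm : ∀ i, Odd (deg i) → m i ≤ 1
  · exact coeff_val (leftDeriv j f) ⟨m, hm⟩
  · rw [coeff_of_not_adm hm, coeff_of_not_adm, mul_zero, mul_zero]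
    exact fun h => hm fun i hi => le_trans (by simp) (h i hi)

theorem coeff_rightDeriv (j : J) (f : GSeries K deg) (m : J →₀ ℕ) :
    coeff m (rightDeriv j f) = koszul K (deg j * ∑ i with j < i, m i * deg i) *
      ((m j + 1 : K) * coeff (m + Finsupp.single j (1 : ℕ)) f) := by
  by_cases hm : ∀ i, Odd (deg i) → m i ≤ 1
  · exact coeff_val (rightDeriv j f) ⟨m, hm⟩
  · rw [coeff_of_not_adm hm, coeff_of_not_adm, mul_zero, mul_zero]
    exact fun h => hm fun i hi => le_trans (by simp) (h i hi)

theorem sum_eq_sum_lt_add (j : J) (g : J → ℤ) :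
    ∑ i, g i = (∑ i with i < j, g i) + g j + ∑ i with j < i, g i := by
  have h1 : ∀ i, g i = (if i < j then g i else 0) + (if i = j then g i else 0) +
      (if j < i then g i else 0) := by
    intro i
    rcases lt_trichotomy i j with h | h | h
    · simp [h, h.ne, h.not_gt]
    · simp [h]
    · simp [h, h.ne', h.not_gt]
  rw [Finset.sum_congr rfl fun i _ => h1 i, Finset.sum_add_distrib, Finset.sum_add_distrib,
    Finset.sum_filter, Finset.sum_filter]
  simp

theorem crossing_single_left (j : J) (v : J →₀ ℕ) :
    crossing deg (Finsupp.single j (1 : ℕ)) v = deg j * ∑ i with i < j, v i * deg i := by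
  rw [crossing, Finset.sum_eq_single j]
  · simp [Finset.mul_sum]
  · intro i _ hi
    simp [hi.symm]
  · simp

theorem crossing_single_right (j : J) (u : J →₀ ℕ) :
    crossing deg u (Finsupp.single j (1 : ℕ)) = deg j * ∑ i with j < i, u i * deg i := by
  rw [crossing, Finset.mul_sum, Finset.sum_filter]
  refine Finset.sum_congr rfl fun i _ => ?_
  rw [Finset.sum_filter, Finset.sum_eq_single j]
  · simp only [Finsupp.single_eq_same]
    split_ifs
    · push_cast
      ring
    · rfl
  · intro k _ hk
    simp [hk.symm]
  · simp

/-- The left partial derivatives are graded derivations. The superinteger `superNat` satisfies the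
one-variable case `[a + b] = [a] + (-1)^(a|x_j|) [b]` for all exponents, so that the monomials with a
repeated odd variable need no separate treatment. -/
theorem leftDeriv_mul (j : J) {f : GSeries K deg} {p : ℤ} (hf : f ∈ homog K deg p)
    (g : GSeries K deg) :
    leftDeriv j (f * g) = leftDeriv j f * g + koszul K (deg j * p) • (f * leftDeriv j g) := by
  refine ext_coeff fun ⟨m, hm⟩ => ?_
  have hL : coeff m (leftDeriv j (f * g)) = koszul K (deg j * ∑ i with i < j, m i * deg i) *
      ∑ x ∈ antidiagonal (m + Finsupp.single j (1 : ℕ)), superNat K (deg j) (x.1 j + x.2 j) *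
        (koszul K (crossing deg x.1 x.2) * (coeff x.1 f * coeff x.2 g)) := by
    have h1 : ∀ x ∈ antidiagonal (m + Finsupp.single j (1 : ℕ)), x.1 j + x.2 j = m j + 1 := by
      intro x hx
      rw [mem_antidiagonal] at hx
      simpa using DFunLike.congr_fun hx j
    rw [coeff_leftDeriv, ← superNat_mul_coeff]
    congr 1
    trans superNat K (deg j) (m j + 1) * ∑ x ∈ antidiagonal (m + Finsupp.single j (1 : ℕ)),
      koszul K (crossing deg x.1 x.2) * (coeff x.1 f * coeff x.2 g)
    swap
    · rw [Finset.mul_sum]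
      exact Finset.sum_congr rfl fun x hx => by rw [h1 x hx]
    by_cases ha : ∀ i, Odd (deg i) → (m + Finsupp.single j (1 : ℕ)) i ≤ 1
    · rw [coeff_mul _ _ _ ha]
    · have h0 : superNat K (deg j) (m j + 1) = 0 := by
        push Not at ha
        obtain ⟨i, hi, hi2⟩ := ha
        have hmi := hm i hi
        have hij : j = i := by
          by_contra hne
          simp [hne] at hi2
          omega
        subst hij
        have : m j = 1 := by
          simp at hi2
          omega
        simp [superNat, hi, this]
      rw [h0, zero_mul, zero_mul]
  have hR1 : coeff m (leftDeriv j f * g) = ∑ x ∈ antidiagonal (m + Finsupp.single j (1 : ℕ)),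
      koszul K (deg j * ∑ i with i < j, m i * deg i) * (superNat K (deg j) (x.1 j) *
        (koszul K (crossing deg x.1 x.2) * (coeff x.1 f * coeff x.2 g))) := by
    rw [sum_antidiagonal_add_single_left, coeff_mul _ _ _ hm]
    · refine Finset.sum_congr rfl fun x hx => ?_
      rw [mem_antidiagonal] at hx
      rw [coeff_leftDeriv, ← superNat_mul_coeff]
      simp only [Finsupp.add_apply, Finsupp.single_eq_same]
      have hs : koszul K (crossing deg x.1 x.2) *
          koszul K (deg j * ∑ i with i < j, x.1 i * deg i) =
          koszul K (deg j * ∑ i with i < j, m i * deg i) *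
          koszul K (crossing deg (x.1 + Finsupp.single j (1 : ℕ)) x.2) := by
        rw [← koszul_add, ← koszul_add, crossing_add_left, crossing_single_left]
        refine koszul_congr K ?_
        have : ∑ i with i < j, (m i : ℤ) * deg i = (∑ i with i < j, (x.1 i : ℤ) * deg i) +
            ∑ i with i < j, (x.2 i : ℤ) * deg i := by
          rw [← Finset.sum_add_distrib, ← hx]
          refine Finset.sum_congr rfl fun i _ => ?_
          rw [Finsupp.add_apply]
          push_cast
          ring
        rw [this, Int.cast_add, Int.cast_add, Int.cast_mul, Int.cast_mul, Int.cast_add,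
          Int.cast_add, Int.cast_mul]
        generalize ((crossing deg x.1 x.2 : ℤ) : ZMod 2) = a
        generalize ((∑ i with i < j, (x.1 i : ℤ) * deg i : ℤ) : ZMod 2) = b
        generalize ((∑ i with i < j, (x.2 i : ℤ) * deg i : ℤ) : ZMod 2) = c
        generalize ((deg j : ℤ) : ZMod 2) = e
        revert a b c e
        decide
      linear_combination (superNat K (deg j) (x.1 j + 1) *
        coeff (x.1 + Finsupp.single j (1 : ℕ)) f * coeff x.2 g) * hs
    · intro p q h
      simp [h, superNat_zero]
  have hR2 : coeff m (koszul K (deg j * p) • (f * leftDeriv j g)) =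
      ∑ x ∈ antidiagonal (m + Finsupp.single j (1 : ℕ)),
      koszul K (deg j * ∑ i with i < j, m i * deg i) * (koszul K (x.1 j * deg j) *
        superNat K (deg j) (x.2 j) *
        (koszul K (crossing deg x.1 x.2) * (coeff x.1 f * coeff x.2 g))) := by
    rw [sum_antidiagonal_add_single_right, map_smul, coeff_mul _ _ _ hm, smul_eq_mul,
      Finset.mul_sum]
    · refine Finset.sum_congr rfl fun x hx => ?_
      rw [mem_antidiagonal] at hx
      rw [coeff_leftDeriv, ← superNat_mul_coeff]
      simp only [Finsupp.add_apply, Finsupp.single_eq_same]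
      by_cases hp : monDegree deg x.1 = p
      swap
      · rw [coeff_eq_zero_of_mem_homog hf hp]
        ring
      have hs : koszul K (deg j * p) * koszul K (crossing deg x.1 x.2) *
          koszul K (deg j * ∑ i with i < j, x.2 i * deg i) =
          koszul K (deg j * ∑ i with i < j, m i * deg i) * koszul K (x.1 j * deg j) *
          koszul K (crossing deg x.1 (x.2 + Finsupp.single j (1 : ℕ))) := by
        rw [← koszul_add, ← koszul_add, ← koszul_add, ← koszul_add, crossing_add_right,
          crossing_single_right]
        refine koszul_congr K ?_
        have : ∑ i with i < j, (m i : ℤ) * deg i = (∑ i with i < j, (x.1 i : ℤ) * deg i) +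
            ∑ i with i < j, (x.2 i : ℤ) * deg i := by
          rw [← Finset.sum_add_distrib, ← hx]
          refine Finset.sum_congr rfl fun i _ => ?_
          rw [Finsupp.add_apply]
          push_cast
          ring
        rw [this, ← hp, monDegree_eq_sum, sum_eq_sum_lt_add j]
        simp only [Int.cast_add, Int.cast_mul]
        generalize ((crossing deg x.1 x.2 : ℤ) : ZMod 2) = a
        generalize ((∑ i with i < j, (x.1 i : ℤ) * deg i : ℤ) : ZMod 2) = b
        generalize ((∑ i with j < i, (x.1 i : ℤ) * deg i : ℤ) : ZMod 2) = b'
        generalize ((∑ i with i < j, (x.2 i : ℤ) * deg i : ℤ) : ZMod 2) = c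
        generalize (((x.1 j : ℕ) : ℤ) : ZMod 2) = y
        generalize ((deg j : ℤ) : ZMod 2) = e
        revert a b b' c y e
        decide
      linear_combination (superNat K (deg j) (x.2 j + 1) *
        coeff (x.2 + Finsupp.single j (1 : ℕ)) g * coeff x.1 f) * hs
    · intro p q h
      simp [h, superNat_zero]
  change coeff m _ = coeff m _
  rw [map_add, hL, hR1, hR2, Finset.mul_sum, ← Finset.sum_add_distrib]
  refine Finset.sum_congr rfl fun x _ => ?_
  rw [superNat_add]
  ring

/-- Only the pairs of equal variables prevent the crossings of `u v` and of `v u` from adding up to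
`|u| |v|`, and an odd variable does not occur in both `u` and `v`. -/
theorem crossing_add_crossing_swap (u v : J →₀ ℕ) (h : ∀ j, Odd (deg j) → (u + v) j ≤ 1) :
    ((crossing deg u v + crossing deg v u : ℤ) : ZMod 2) =
      ((monDegree deg u * monDegree deg v : ℤ) : ZMod 2) := by
  have h1 : monDegree deg u * monDegree deg v = crossing deg u v + crossing deg v u +
      ∑ i, (u i * deg i) * (v i * deg i) := by
    have h2 : crossing deg v u = ∑ i, ∑ j with i < j, (u i * deg i) * (v j * deg j) := by
      simp only [crossing, Finset.sum_filter]
      rw [Finset.sum_comm]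
      refine Finset.sum_congr rfl fun i _ => Finset.sum_congr rfl fun j _ => ?_
      split_ifs <;> ring
    rw [h2, crossing, ← Finset.sum_add_distrib, ← Finset.sum_add_distrib, monDegree_eq_sum,
      monDegree_eq_sum, Finset.sum_mul]
    refine Finset.sum_congr rfl fun i _ => ?_
    rw [Finset.mul_sum, sum_eq_sum_lt_add i]
    ring
  rw [h1, Int.cast_add _ (∑ i, _), Int.cast_sum, Finset.sum_eq_zero, add_zero]
  intro i _
  by_cases hi : Odd (deg i)
  · have := h i hi
    rw [Finsupp.add_apply] at this
    rcases Nat.eq_zero_or_pos (u i) with h0 | h0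
    · simp [h0]
    · simp [show v i = 0 by omega]
  · have : ((deg i : ℤ) : ZMod 2) = 0 := by
      rw [ZMod.intCast_zmod_eq_zero_iff_dvd]
      exact even_iff_two_dvd.1 (Int.not_odd_iff_even.1 hi)
    simp [this]

theorem mul_comm_of_mem_homog {f g : GSeries K deg} {p q : ℤ} (hf : f ∈ homog K deg p)
    (hg : g ∈ homog K deg q) : g * f = koszul K (p * q) • (f * g) := by
  refine ext_coeff fun ⟨m, hm⟩ => ?_
  change coeff m _ = coeff m _
  rw [map_smul, coeff_mul _ _ _ hm, coeff_mul _ _ _ hm, Finset.smul_sum,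
    Finsupp.sum_antidiagonal_swap m
      fun a b => koszul K (crossing deg a b) * (coeff a g * coeff b f)]
  refine Finset.sum_congr rfl fun x hx => ?_
  rw [smul_eq_mul]
  by_cases hp : monDegree deg x.1 = p
  swap
  · rw [coeff_eq_zero_of_mem_homog hf hp]
    ring
  by_cases hq : monDegree deg x.2 = q
  swap
  · rw [coeff_eq_zero_of_mem_homog hg hq]
    ring
  rw [mem_antidiagonal] at hx
  have hs : koszul K (crossing deg x.2 x.1) = koszul K (p * q) * koszul K (crossing deg x.1 x.2) := by
    rw [← koszul_add]
    refine koszul_congr K ?_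
    have := crossing_add_crossing_swap x.1 x.2 (by rwa [hx])
    rw [Int.cast_add, ← hp, ← hq, ← this]
    push_cast
    generalize ((crossing deg x.1 x.2 : ℤ) : ZMod 2) = a
    generalize ((crossing deg x.2 x.1 : ℤ) : ZMod 2) = b
    revert a b
    decide
  rw [hs]
  ring

theorem mul_mem_homog {f g : GSeries K deg} {p q : ℤ} (hf : f ∈ homog K deg p)
    (hg : g ∈ homog K deg q) : f * g ∈ homog K deg (p + q) := by
  rintro ⟨m, hm⟩ hne
  rw [← coeff_val, coeff_mul _ _ _ hm]
  refine Finset.sum_eq_zero fun x hx => ?_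
  rw [mem_antidiagonal] at hx
  by_cases hp : monDegree deg x.1 = p
  · have hq : monDegree deg x.2 ≠ q := fun hq => hne (by
      change monDegree deg m = p + q
      rw [← hx, monDegree_add, hp, hq])
    rw [coeff_eq_zero_of_mem_homog hg hq]
    ring
  · rw [coeff_eq_zero_of_mem_homog hf hp]
    ring

theorem one_mem_homog : (1 : GSeries K deg) ∈ homog K deg 0 := by
  rw [mem_homog_iff]
  intro m hm
  rw [coeff_one, if_neg]
  rintro rfl
  exact hm monDegree_zero

theorem leftDeriv_mem_homog (j : J) {f : GSeries K deg} {p : ℤ} (hf : f ∈ homog K deg p) :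
    leftDeriv j f ∈ homog K deg (p - deg j) := by
  rw [mem_homog_iff] at hf ⊢
  intro m hm
  rw [coeff_leftDeriv, hf, mul_zero, mul_zero]
  rw [monDegree_add, monDegree_single]
  intro h
  exact hm (by omega)

/-- Moving `x_j` from the left end of a monomial to its right end. -/
theorem rightDeriv_eq_leftDeriv (j : J) {f : GSeries K deg} {p : ℤ} (hf : f ∈ homog K deg p) :
    rightDeriv j f = koszul K (deg j * (p + 1)) • leftDeriv j f := by
  refine ext_coeff fun ⟨m, hm⟩ => ?_
  change coeff m _ = coeff m _
  rw [map_smul, coeff_leftDeriv, coeff_rightDeriv, smul_eq_mul, ← mul_assoc]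
  by_cases hp : monDegree deg (m + Finsupp.single j (1 : ℕ)) = p
  swap
  · rw [coeff_eq_zero_of_mem_homog hf hp]
    ring
  by_cases hj : ∀ i, Odd (deg i) → (m + Finsupp.single j (1 : ℕ)) i ≤ 1
  swap
  · rw [coeff_of_not_adm hj]
    ring
  rw [← mul_assoc, ← mul_assoc, ← koszul_add]
  congr 2
  refine koszul_congr K ?_
  rw [← hp, monDegree_add, monDegree_single, monDegree_eq_sum, sum_eq_sum_lt_add j]
  have h0 : ((deg j : ℤ) : ZMod 2) * ((m j : ℤ) : ZMod 2) = 0 := by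
    by_cases ho : Odd (deg j)
    · have := hj j ho
      simp only [Finsupp.add_apply, Finsupp.single_eq_same] at this
      simp [show m j = 0 by omega]
    · have : ((deg j : ℤ) : ZMod 2) = 0 := by
        rw [ZMod.intCast_zmod_eq_zero_iff_dvd]
        exact even_iff_two_dvd.1 (Int.not_odd_iff_even.1 ho)
      simp [this]
  revert h0
  simp only [Int.cast_add, Int.cast_mul]
  generalize ((∑ i with i < j, (m i : ℤ) * deg i : ℤ) : ZMod 2) = b
  generalize ((∑ i with j < i, (m i : ℤ) * deg i : ℤ) : ZMod 2) = b'
  generalize (((m j : ℕ) : ℤ) : ZMod 2) = y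
  generalize ((deg j : ℤ) : ZMod 2) = e
  revert b b' y e
  decide

theorem rightDeriv_mem_homog (j : J) {f : GSeries K deg} {p : ℤ} (hf : f ∈ homog K deg p) :
    rightDeriv j f ∈ homog K deg (p - deg j) := by
  rw [rightDeriv_eq_leftDeriv j hf]
  exact Submodule.smul_mem _ _ (leftDeriv_mem_homog j hf)

theorem leftDeriv_comm (i j : J) (f : GSeries K deg) :
    leftDeriv i (leftDeriv j f) = koszul K (deg i * deg j) • leftDeriv j (leftDeriv i f) := by
  wlog hij : i ≤ j generalizing i j
  · rw [this j i (le_of_not_ge hij), smul_smul, mul_comm (deg j), koszul_mul_self, one_smul]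
  refine ext_coeff fun ⟨m, hm⟩ => ?_
  change coeff m _ = coeff m _
  rw [map_smul]
  simp only [coeff_leftDeriv, smul_eq_mul]
  rcases hij.eq_or_lt with rfl | hlt
  · by_cases ho : Odd (deg i)
    · rw [coeff_of_not_adm]
      · ring
      · intro h
        have := h i ho
        simp only [Finsupp.add_apply, Finsupp.single_eq_same] at this
        omega
    · rw [koszul_of_even K (n := deg i * deg i)
        (Int.even_mul.2 (Or.inl (Int.not_odd_iff_even.1 ho))), one_mul]
  · have h1 : ∑ k with k < j, ((m + Finsupp.single i (1 : ℕ)) k : ℤ) * deg k =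
        (∑ k with k < j, (m k : ℤ) * deg k) + deg i := by
      rw [← monDegree_single (deg := deg) i, monDegree_eq_sum]
      simp only [Finsupp.add_apply, Nat.cast_add, add_mul, Finset.sum_add_distrib]
      congr 1
      rw [Finset.sum_filter]
      refine Finset.sum_congr rfl fun k _ => ?_
      by_cases hk : i = k
      · subst hk
        simp [hlt]
      · simp [hk]
    have h2 : ∑ k with k < i, ((m + Finsupp.single j (1 : ℕ)) k : ℤ) * deg k =
        ∑ k with k < i, (m k : ℤ) * deg k := by
      refine Finset.sum_congr rfl fun k hk => ?_
      have : j ≠ k := ((Finset.mem_filter.1 hk).2.trans hlt).ne'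
      simp [this]
    have e1 : (m + Finsupp.single i (1 : ℕ)) j = m j := by simp [hlt.ne]
    have e2 : (m + Finsupp.single j (1 : ℕ)) i = m i := by simp [hlt.ne']
    rw [h1, h2, e1, e2, add_right_comm m, mul_add, koszul_add, mul_comm (deg j) (deg i)]
    ring

theorem leftDeriv_rightDeriv_comm {i j : J} {f : GSeries K deg} {p : ℤ} (hf : f ∈ homog K deg p) :
    leftDeriv i (rightDeriv j f) = rightDeriv j (leftDeriv i f) := by
  rw [rightDeriv_eq_leftDeriv j hf, rightDeriv_eq_leftDeriv j (leftDeriv_mem_homog i hf), map_smul,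
    leftDeriv_comm, smul_smul, ← koszul_add]
  congr 1
  refine koszul_congr K ?_
  push_cast
  generalize ((deg i : ℤ) : ZMod 2) = a
  generalize ((deg j : ℤ) : ZMod 2) = b
  generalize ((p : ℤ) : ZMod 2) = c
  revert a b c
  decide

theorem rightDeriv_comm (i j : J) {f : GSeries K deg} {p : ℤ} (hf : f ∈ homog K deg p) :
    rightDeriv i (rightDeriv j f) = koszul K (deg i * deg j) • rightDeriv j (rightDeriv i f) := by
  rw [rightDeriv_eq_leftDeriv i (rightDeriv_mem_homog j hf), leftDeriv_rightDeriv_comm hf,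
    rightDeriv_eq_leftDeriv i hf, map_smul, smul_smul, ← koszul_add]
  congr 1
  refine koszul_congr K ?_
  push_cast
  generalize ((deg i : ℤ) : ZMod 2) = a
  generalize ((deg j : ℤ) : ZMod 2) = b
  generalize ((p : ℤ) : ZMod 2) = c
  revert a b c
  decide

end

end GSeries

namespace GSeries

variable {K : Type*} [Field K] {J : Type*} [Fintype J] [LinearOrder J] {deg : J → ℤ}

/-- The right partial derivatives are graded derivations acting from the right. -/
theorem rightDeriv_mul (j : J) {f g : GSeries K deg} {p q : ℤ} (hf : f ∈ homog K deg p)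
    (hg : g ∈ homog K deg q) :
    rightDeriv j (f * g) = f * rightDeriv j g + koszul K (deg j * q) • (rightDeriv j f * g) := by
  rw [rightDeriv_eq_leftDeriv j (mul_mem_homog hf hg), rightDeriv_eq_leftDeriv j hf,
    rightDeriv_eq_leftDeriv j hg, leftDeriv_mul j hf, smul_mul_assoc, mul_smul_comm, smul_add,
    koszul_smul_smul, koszul_smul_smul, add_comm]
  congr 2 <;>
  · refine koszul_congr K ?_
    push_cast
    generalize ((deg j : ℤ) : ZMod 2) = a
    generalize ((p : ℤ) : ZMod 2) = b
    generalize ((q : ℤ) : ZMod 2) = c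
    revert a b c
    decide

end GSeries

/-! ### Functions inside polyvector fields -/

section PolyVec

open GSeries
open Finset.HasAntidiagonal (antidiagonal mem_antidiagonal)

theorem sum_lex {ι M : Type*} [Fintype ι] [AddCommMonoid M] (g : ι ⊕ₗ ι → M) :
    ∑ x, g x = ∑ a, g (Sum.inlₗ a) + ∑ a, g (Sum.inrₗ a) := by
  rw [← Fintype.sum_sum_type fun x => g (toLex x)]
  exact (Equiv.sum_comp toLex g).symm

theorem inl_injective {ι : Type*} : Function.Injective (fun a => (Sum.inlₗ a : ι ⊕ₗ ι)) :=
  fun _ _ h => Sum.inl_injective (toLex.injective h)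

/-- The exponent of a monomial in the coordinates `t^a` as an exponent in the `t^a` and `ψ_a`. -/
noncomputable def embExp {ι : Type*} (m : ι →₀ ℕ) : ι ⊕ₗ ι →₀ ℕ :=
  Finsupp.mapDomain (fun a => (Sum.inlₗ a : ι ⊕ₗ ι)) m

section

variable {ι : Type*}

theorem embExp_inl (m : ι →₀ ℕ) (a : ι) : embExp m (Sum.inlₗ a) = m a :=
  Finsupp.mapDomain_apply inl_injective m a

theorem embExp_inr (m : ι →₀ ℕ) (a : ι) : embExp m (Sum.inrₗ a) = 0 :=
  Finsupp.mapDomain_of_notMem_range _ _ (by rintro ⟨b, hb⟩; exact Sum.inl_ne_inr (toLex.injective hb))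

theorem embExp_add (u v : ι →₀ ℕ) : embExp (u + v) = embExp u + embExp v :=
  Finsupp.mapDomain_add

theorem embExp_single (a : ι) (k : ℕ) :
    embExp (Finsupp.single a k) = Finsupp.single (Sum.inlₗ a) k :=
  Finsupp.mapDomain_single

theorem embExp_injective : Function.Injective (embExp (ι := ι)) :=
  Finsupp.mapDomain_injective inl_injective

theorem polyDeg_inl {δ : ι → ℤ} (a : ι) : polyDeg δ (Sum.inlₗ a) = coordDeg δ a := rfl

theorem polyDeg_inr {δ : ι → ℤ} (a : ι) : polyDeg δ (Sum.inrₗ a) = 1 - coordDeg δ a := rfl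

theorem embExp_adm {δ : ι → ℤ} (m : ι →₀ ℕ) :
    (∀ x, Odd (polyDeg δ x) → embExp m x ≤ 1) ↔ ∀ a, Odd (coordDeg δ a) → m a ≤ 1 := by
  constructor
  · intro h a ha
    have := h (Sum.inlₗ a) ha
    rwa [embExp_inl] at this
  · intro h x hx
    rcases x with a | a
    · exact (embExp_inl m a).le.trans (h a hx)
    · exact (embExp_inr m a).le.trans zero_le_one

end

section

variable {ι : Type*} [Fintype ι]

theorem weight_add (u v : ι ⊕ₗ ι →₀ ℕ) : weight (u + v) = weight u + weight v := by
  simp [weight, Finset.sum_add_distrib]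

theorem weight_single_inr (a : ι) : weight (Finsupp.single (Sum.inrₗ a : ι ⊕ₗ ι) 1) = 1 := by
  classical
  rw [weight, Finset.sum_eq_single a]
  · simp
  · intro b _ hb
    rw [Finsupp.single_apply, if_neg]
    exact fun h => hb (Sum.inr_injective (toLex.injective h)).symm
  · simp

theorem weight_single_inl (a : ι) : weight (Finsupp.single (Sum.inlₗ a : ι ⊕ₗ ι) 1) = 0 := by
  classical
  rw [weight, Finset.sum_eq_zero]
  intro b _
  rw [Finsupp.single_apply, if_neg]
  exact fun h => Sum.inl_ne_inr (toLex.injective h)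

theorem weight_embExp (m : ι →₀ ℕ) : weight (embExp m) = 0 := by
  simp [weight, embExp_inr]

theorem exists_embExp {m : ι ⊕ₗ ι →₀ ℕ} (hm : weight m = 0) : ∃ u, embExp u = m := by
  refine ⟨m.comapDomain _ inl_injective.injOn, Finsupp.mapDomain_comapDomain _ inl_injective _ ?_⟩
  intro x hx
  rcases x with a | a
  · exact ⟨a, rfl⟩
  · rw [weight, Finset.sum_eq_zero_iff] at hm
    exact absurd (hm a (Finset.mem_univ a)) (Finsupp.mem_support_iff.1 hx)

theorem monDegree_embExp {δ : ι → ℤ} (m : ι →₀ ℕ) :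
    monDegree (polyDeg δ) (embExp m) = monDegree (coordDeg δ) m := by
  rw [monDegree_eq_sum, monDegree_eq_sum, sum_lex]
  simp [embExp_inl, embExp_inr, polyDeg]

end

theorem coeff_setPsiZero {K : Type*} [Field K] {ι : Type*} {δ : ι → ℤ}
    (A : PolyVec K δ) (m : ι →₀ ℕ) :
    coeff m (setPsiZero A) = coeff (embExp m) A := by
  by_cases hm : ∀ a, Odd (coordDeg δ a) → m a ≤ 1
  · exact coeff_val (setPsiZero A) ⟨m, hm⟩
  · rw [coeff_of_not_adm hm, coeff_of_not_adm]
    rwa [embExp_adm]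

variable {K : Type*} [Field K] {ι : Type*} [Fintype ι] [LinearOrder ι] {δ : ι → ℤ}

theorem sum_embExp_lt (m : ι →₀ ℕ) (a : ι) :
    ∑ x with x < Sum.inlₗ a, (embExp m x : ℤ) * polyDeg δ x =
      ∑ b with b < a, (m b : ℤ) * coordDeg δ b := by
  rw [Finset.sum_filter, Finset.sum_filter, sum_lex]
  simp only [embExp_inl, embExp_inr, Sum.Lex.inl_lt_inl_iff]
  simp [polyDeg]

theorem crossing_embExp (u v : ι →₀ ℕ) :
    crossing (polyDeg δ) (embExp u) (embExp v) = crossing (coordDeg δ) u v := by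
  rw [crossing, crossing, sum_lex]
  simp only [embExp_inl, embExp_inr]
  simp only [← Finset.mul_sum, sum_embExp_lt]
  simp [polyDeg]

theorem setPsiZero_add (A B : PolyVec K δ) :
    setPsiZero (A + B) = setPsiZero A + setPsiZero B :=
  ext_coeff fun m => by rw [map_add]; simp only [coeff_setPsiZero, map_add]

theorem setPsiZero_smul (c : K) (A : PolyVec K δ) : setPsiZero (c • A) = c • setPsiZero A :=
  ext_coeff fun m => by rw [map_smul]; simp only [coeff_setPsiZero, map_smul]

/-- The restriction to `ψ = 0` as a linear map. -/
noncomputable def setPsiZeroₗ : PolyVec K δ →ₗ[K] FunctionAlg K δ where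
  toFun := setPsiZero
  map_add' := setPsiZero_add
  map_smul' := setPsiZero_smul

theorem setPsiZero_zero : setPsiZero (0 : PolyVec K δ) = 0 := map_zero (setPsiZeroₗ (δ := δ))

theorem setPsiZero_sum {α : Type*} (s : Finset α) (A : α → PolyVec K δ) :
    setPsiZero (∑ x ∈ s, A x) = ∑ x ∈ s, setPsiZero (A x) :=
  map_sum (setPsiZeroₗ (δ := δ)) A s

theorem setPsiZero_mul (A B : PolyVec K δ) : setPsiZero (A * B) = setPsiZero A * setPsiZero B := by
  refine ext_coeff fun ⟨m, hm⟩ => ?_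
  change coeff m _ = coeff m _
  rw [coeff_setPsiZero, coeff_mul _ _ _ ((embExp_adm m).2 hm), coeff_mul _ _ _ hm]
  symm
  refine Finset.sum_of_injOn (fun x => (embExp x.1, embExp x.2)) ?_ ?_ ?_ ?_
  · rintro ⟨a, b⟩ _ ⟨c, d⟩ _ h
    simp only [Prod.mk.injEq] at h
    rw [embExp_injective h.1, embExp_injective h.2]
  · rintro ⟨a, b⟩ h
    simp only [Finset.mem_coe, mem_antidiagonal] at h ⊢
    rw [← h, embExp_add]
  · rintro ⟨a, b⟩ h h'
    simp only [mem_antidiagonal] at h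
    have hw := weight_embExp m
    rw [← h, weight_add] at hw
    obtain ⟨u, rfl⟩ := exists_embExp (m := a) (by omega)
    obtain ⟨v, rfl⟩ := exists_embExp (m := b) (by omega)
    refine absurd ⟨(u, v), ?_, rfl⟩ h'
    rw [Finset.mem_coe, mem_antidiagonal]
    exact embExp_injective (by rw [embExp_add]; exact h)
  · intro x _
    rw [crossing_embExp, coeff_setPsiZero, coeff_setPsiZero]

theorem setPsiZero_one : setPsiZero (1 : PolyVec K δ) = 1 := by
  refine ext_coeff fun ⟨m, hm⟩ => ?_
  change coeff m _ = coeff m _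
  rw [coeff_setPsiZero, coeff_one, coeff_one]
  congr 1
  rw [← embExp_injective.eq_iff (a := m), embExp, embExp, Finsupp.mapDomain_zero]

theorem setPsiZero_leftDeriv (a : ι) (A : PolyVec K δ) :
    setPsiZero (leftDeriv (Sum.inlₗ a) A) = leftDeriv a (setPsiZero A) := by
  refine ext_coeff fun ⟨m, hm⟩ => ?_
  change coeff m _ = coeff m _
  rw [coeff_setPsiZero, coeff_leftDeriv, coeff_leftDeriv, coeff_setPsiZero, embExp_add,
    embExp_single, sum_embExp_lt, embExp_inl]
  rfl

omit [LinearOrder ι] in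
theorem setPsiZero_mem_homog {A : PolyVec K δ} {d : ℤ} (hA : A ∈ homog K (polyDeg δ) d) :
    setPsiZero A ∈ homog K (coordDeg δ) d := by
  rw [mem_homog_iff]
  intro m hm
  rw [coeff_setPsiZero]
  exact coeff_eq_zero_of_mem_homog hA (by rwa [monDegree_embExp])

open Classical in
/-- A function, viewed as a polyvector field that does not depend on `ψ`. -/
noncomputable def incl : FunctionAlg K δ →ₗ[K] PolyVec K δ where
  toFun f := ⟨fun m => if weight m.1 = 0 then
    coeff (m.1.comapDomain _ inl_injective.injOn) f else 0⟩
  map_add' f g := by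
    ext m
    simp only [val_add, map_add]
    split_ifs <;> simp
  map_smul' c f := by
    ext m
    simp only [val_smul, map_smul, smul_eq_mul, RingHom.id_apply]
    split_ifs <;> simp

theorem coeff_incl_of_weight_ne {m : ι ⊕ₗ ι →₀ ℕ} (hm : weight m ≠ 0) (f : FunctionAlg K δ) :
    coeff m (incl f) = 0 := by
  by_cases h : ∀ x, Odd (polyDeg δ x) → m x ≤ 1
  · exact (coeff_val (incl f) ⟨m, h⟩).trans (if_neg hm)
  · exact coeff_of_not_adm h _

theorem coeff_embExp_incl (m : ι →₀ ℕ) (f : FunctionAlg K δ) :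
    coeff (embExp m) (incl f) = coeff m f := by
  by_cases h : ∀ x, Odd (polyDeg δ x) → embExp m x ≤ 1
  · refine (coeff_val (incl f) ⟨_, h⟩).trans ((if_pos (weight_embExp m)).trans ?_)
    congr 1
    exact congrArg (fun u => coeff u) (Finsupp.comapDomain_mapDomain _ inl_injective m)
  · rw [coeff_of_not_adm h, coeff_of_not_adm]
    rwa [embExp_adm] at h

theorem setPsiZero_incl (f : FunctionAlg K δ) : setPsiZero (incl f) = f :=
  ext_coeff fun m => by rw [coeff_setPsiZero, coeff_embExp_incl]

theorem rightDeriv_incl (a : ι) (f : FunctionAlg K δ) :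
    rightDeriv (Sum.inrₗ a) (incl f) = 0 := by
  refine ext_coeff fun ⟨m, hm⟩ => ?_
  change coeff m _ = coeff m _
  rw [coeff_rightDeriv, coeff_incl_of_weight_ne, mul_zero, mul_zero, map_zero]
  rw [weight_add, weight_single_inr]
  omega

theorem leftDeriv_incl (a : ι) (f : FunctionAlg K δ) :
    leftDeriv (Sum.inlₗ a) (incl f) = incl (leftDeriv a f) := by
  refine ext_coeff fun ⟨m, hm⟩ => ?_
  change coeff m _ = coeff m _
  by_cases hw : weight m = 0
  · obtain ⟨u, rfl⟩ := exists_embExp hw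
    rw [← coeff_setPsiZero, ← coeff_setPsiZero, setPsiZero_leftDeriv, setPsiZero_incl,
      setPsiZero_incl]
  · rw [coeff_leftDeriv, coeff_incl_of_weight_ne, coeff_incl_of_weight_ne hw, mul_zero, mul_zero]
    rwa [weight_add, weight_single_inl]

theorem incl_mem_homog {f : FunctionAlg K δ} {d : ℤ} (hf : f ∈ homog K (coordDeg δ) d) :
    incl f ∈ homog K (polyDeg δ) d := by
  rw [mem_homog_iff]
  intro m hm
  by_cases hw : weight m = 0
  · obtain ⟨u, rfl⟩ := exists_embExp hw
    rw [coeff_embExp_incl]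
    exact coeff_eq_zero_of_mem_homog hf (by rwa [monDegree_embExp] at hm)
  · exact coeff_incl_of_weight_ne hw f

/-! ### The odd Poisson algebra of polyvector fields -/

theorem bullet_mem_homog {A B : PolyVec K δ} {p q : ℤ} (hA : A ∈ homog K (polyDeg δ) p)
    (hB : B ∈ homog K (polyDeg δ) q) : bullet A B ∈ homog K (polyDeg δ) (p + q - 1) := by
  refine Submodule.sum_mem _ fun a _ => ?_
  have h := mul_mem_homog (rightDeriv_mem_homog (Sum.inrₗ a) hA)
    (leftDeriv_mem_homog (Sum.inlₗ a) hB)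
  rw [polyDeg_inl, polyDeg_inr] at h
  have e : p + q - 1 = p - (1 - coordDeg δ a) + (q - coordDeg δ a) := by ring
  rwa [e]

theorem bullet_add_left (A A' B : PolyVec K δ) : bullet (A + A') B = bullet A B + bullet A' B := by
  simp only [bullet, map_add, add_mul, Finset.sum_add_distrib]

theorem bullet_smul_left (c : K) (A B : PolyVec K δ) : bullet (c • A) B = c • bullet A B := by
  simp only [bullet, map_smul, smul_mul_assoc, Finset.smul_sum]

theorem bullet_smul_right (c : K) (A B : PolyVec K δ) : bullet A (c • B) = c • bullet A B := by
  simp only [bullet, map_smul, mul_smul_comm, Finset.smul_sum]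

theorem bullet_zero_left (B : PolyVec K δ) : bullet 0 B = 0 := by
  simp [bullet]

/-- Only the part of `B` with `ψ = 0` contributes to `A • B` at `ψ = 0`. -/
theorem setPsiZero_bullet (A B : PolyVec K δ) :
    setPsiZero (bullet A B) = setPsiZero (bullet A (incl (setPsiZero B))) := by
  simp only [bullet, setPsiZero_sum, setPsiZero_mul, setPsiZero_leftDeriv, setPsiZero_incl]

/-- The second-order term `∑ ± (∂A/∂ψ_a) (∂B/∂ψ_b) (∂²F/∂t^a∂t^b)`, the amount by which `• F` fails
to be a derivation of `•`. -/
noncomputable def secondOrder (A B F : PolyVec K δ) (q : ℤ) : PolyVec K δ :=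
  ∑ a : ι, ∑ b : ι, koszul K (coordDeg δ a * (q + 1 + coordDeg δ b)) •
    (rightDeriv (Sum.inrₗ a) A * rightDeriv (Sum.inrₗ b) B *
      leftDeriv (Sum.inlₗ a) (leftDeriv (Sum.inlₗ b) F))

theorem secondOrder_symm {A B F : PolyVec K δ} {p q : ℤ} (hA : A ∈ homog K (polyDeg δ) p)
    (hB : B ∈ homog K (polyDeg δ) q) :
    secondOrder A B F q + koszul K (p * q + p + q) • secondOrder B A F p = 0 := by
  have h : secondOrder A B F q = - koszul K (p * q + p + q) • secondOrder B A F p := by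
    rw [secondOrder, secondOrder, Finset.smul_sum, Finset.sum_comm]
    refine Finset.sum_congr rfl fun b _ => ?_
    rw [Finset.smul_sum]
    refine Finset.sum_congr rfl fun a _ => ?_
    rw [mul_comm_of_mem_homog (rightDeriv_mem_homog (Sum.inrₗ b) hB)
      (rightDeriv_mem_homog (Sum.inrₗ a) hA), leftDeriv_comm, mul_smul_comm, smul_mul_assoc,
      koszul_smul_smul, koszul_smul_smul, ← neg_one_mul (koszul K _), ← koszul_one, ← koszul_add,
      koszul_smul_smul]
    congr 1
    refine koszul_congr K ?_
    simp only [polyDeg_inl, polyDeg_inr]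
    push_cast
    generalize ((coordDeg δ a : ℤ) : ZMod 2) = a
    generalize ((coordDeg δ b : ℤ) : ZMod 2) = b
    generalize (p : ZMod 2) = p
    generalize (q : ZMod 2) = q
    revert a b p q
    decide
  rw [h, neg_smul, neg_add_cancel]

/-- Associativity of `•` with a function `F` on the right, up to the second-order term. -/
theorem bullet_bullet {A B F : PolyVec K δ} {p q d : ℤ} (hA : A ∈ homog K (polyDeg δ) p)
    (hB : B ∈ homog K (polyDeg δ) q) (hF : F ∈ homog K (polyDeg δ) d)
    (hF0 : ∀ a, rightDeriv (Sum.inrₗ a) F = 0) :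
    bullet (bullet A B) F = bullet A (bullet B F) +
      koszul K ((1 + d) * (1 + q)) • bullet (bullet A F) B - secondOrder A B F q := by
  have hRF : ∀ a b, rightDeriv (Sum.inrₗ a) (leftDeriv (Sum.inlₗ b) F) = 0 := fun a b => by
    rw [← leftDeriv_rightDeriv_comm hF, hF0, map_zero]
  have h1 : bullet (bullet A B) F = ∑ a, ∑ b,
      (rightDeriv (Sum.inrₗ a) A * rightDeriv (Sum.inrₗ b) (leftDeriv (Sum.inlₗ a) B) *
        leftDeriv (Sum.inlₗ b) F +
      koszul K ((1 + coordDeg δ b) * (q + coordDeg δ a)) •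
        (rightDeriv (Sum.inrₗ b) (rightDeriv (Sum.inrₗ a) A) * leftDeriv (Sum.inlₗ a) B *
          leftDeriv (Sum.inlₗ b) F)) := by
    simp only [bullet, map_sum, Finset.sum_mul]
    rw [Finset.sum_comm]
    refine Finset.sum_congr rfl fun a _ => Finset.sum_congr rfl fun b _ => ?_
    rw [rightDeriv_mul _ (rightDeriv_mem_homog _ hA) (leftDeriv_mem_homog _ hB), add_mul,
      smul_mul_assoc]
    congr 2
    refine koszul_congr K ?_
    simp only [polyDeg_inl, polyDeg_inr]
    push_cast
    generalize ((coordDeg δ a : ℤ) : ZMod 2) = a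
    generalize ((coordDeg δ b : ℤ) : ZMod 2) = b
    generalize (q : ZMod 2) = q
    revert a b q
    decide
  have h2 : bullet A (bullet B F) = (∑ a, ∑ b,
      rightDeriv (Sum.inrₗ a) A * rightDeriv (Sum.inrₗ b) (leftDeriv (Sum.inlₗ a) B) *
        leftDeriv (Sum.inlₗ b) F) + secondOrder A B F q := by
    simp only [bullet, secondOrder, map_sum, Finset.mul_sum]
    rw [← Finset.sum_add_distrib]
    refine Finset.sum_congr rfl fun a _ => ?_
    rw [← Finset.sum_add_distrib]
    refine Finset.sum_congr rfl fun b _ => ?_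
    rw [leftDeriv_mul _ (rightDeriv_mem_homog _ hB), leftDeriv_rightDeriv_comm hB, mul_add,
      mul_smul_comm, mul_assoc, mul_assoc]
    congr 2
    refine koszul_congr K ?_
    simp only [polyDeg_inl, polyDeg_inr]
    push_cast
    generalize ((coordDeg δ a : ℤ) : ZMod 2) = a
    generalize ((coordDeg δ b : ℤ) : ZMod 2) = b
    generalize (q : ZMod 2) = q
    revert a b q
    decide
  have h3 : koszul K ((1 + d) * (1 + q)) • bullet (bullet A F) B = ∑ a, ∑ b,
      koszul K ((1 + coordDeg δ b) * (q + coordDeg δ a)) •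
        (rightDeriv (Sum.inrₗ b) (rightDeriv (Sum.inrₗ a) A) * leftDeriv (Sum.inlₗ a) B *
          leftDeriv (Sum.inlₗ b) F) := by
    simp only [bullet, map_sum, Finset.sum_mul, Finset.smul_sum]
    refine Finset.sum_congr rfl fun a _ => Finset.sum_congr rfl fun b _ => ?_
    rw [rightDeriv_mul _ (rightDeriv_mem_homog _ hA) (leftDeriv_mem_homog _ hF), hRF, mul_zero,
      zero_add, rightDeriv_comm _ _ hA, smul_mul_assoc, smul_mul_assoc, smul_mul_assoc, mul_assoc,
      mul_comm_of_mem_homog (leftDeriv_mem_homog (Sum.inlₗ a) hB)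
        (leftDeriv_mem_homog (Sum.inlₗ b) hF), mul_smul_comm, koszul_smul_smul, koszul_smul_smul,
      koszul_smul_smul, mul_assoc]
    congr 1
    refine koszul_congr K ?_
    simp only [polyDeg_inl, polyDeg_inr]
    push_cast
    generalize ((coordDeg δ a : ℤ) : ZMod 2) = a
    generalize ((coordDeg δ b : ℤ) : ZMod 2) = b
    generalize (q : ZMod 2) = q
    generalize (d : ZMod 2) = d
    revert a b q d
    decide
  rw [h1, h2, h3]
  simp only [Finset.sum_add_distrib]
  abel

/-- The Schouten bracket of homogeneous polyvector fields of degrees `p` and `q`. -/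
noncomputable def homogBracket (p q : ℤ) (A B : PolyVec K δ) : PolyVec K δ :=
  bullet A B + koszul K (p * q + p + q) • bullet B A

/-- The Jacobi identity for two polyvector fields and a function: bracketing with a function is a
graded derivation of the Schouten bracket. The second-order terms cancel because they are graded
antisymmetric. -/
theorem homogBracket_bullet {A B F : PolyVec K δ} {p q d : ℤ} (hA : A ∈ homog K (polyDeg δ) p)
    (hB : B ∈ homog K (polyDeg δ) q) (hF : F ∈ homog K (polyDeg δ) d)
    (hF0 : ∀ a, rightDeriv (Sum.inrₗ a) F = 0) :
    bullet (homogBracket p q A B) F = homogBracket p (q + d - 1) A (bullet B F) +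
      koszul K ((1 + d) * (1 + q)) • homogBracket (p + d - 1) q (bullet A F) B := by
  have e1 : koszul K (p * q + p + q) * koszul K ((1 + d) * (1 + p)) =
      koszul K (p * (q + d - 1) + p + (q + d - 1)) := by
    rw [← koszul_add]
    refine koszul_congr K ?_
    push_cast
    generalize (p : ZMod 2) = p
    generalize (q : ZMod 2) = q
    generalize (d : ZMod 2) = d
    revert p q d
    decide
  have e2 : koszul K (p * q + p + q) = koszul K ((1 + d) * (1 + q)) *
      koszul K ((p + d - 1) * q + (p + d - 1) + q) := by
    rw [← koszul_add]
    refine koszul_congr K ?_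
    push_cast
    generalize (p : ZMod 2) = p
    generalize (q : ZMod 2) = q
    generalize (d : ZMod 2) = d
    revert p q d
    decide
  have hs := secondOrder_symm (F := F) hA hB
  rw [homogBracket, bullet_add_left, bullet_smul_left, bullet_bullet hA hB hF hF0,
    bullet_bullet hB hA hF hF0, homogBracket, homogBracket, ← e1, smul_add _ (bullet _ _), smul_smul,
    ← e2, smul_sub, smul_add, smul_smul, ← sub_eq_zero, ← neg_eq_zero.2 hs]
  abel

end PolyVec

section Iterated

open GSeries

variable {K : Type*} [Field K] {ι : Type*} [Fintype ι] [LinearOrder ι] {δ : ι → ℤ}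

/-! ### Products of homogeneous factors -/

theorem prod_ofFn_mem_homog {J : Type*} [Fintype J] [LinearOrder J] {deg : J → ℤ} :
    ∀ {n : ℕ} {F : Fin n → GSeries K deg} {e : Fin n → ℤ},
    (∀ i, F i ∈ homog K deg (e i)) → (List.ofFn F).prod ∈ homog K deg (∑ i, e i)
  | 0, _, _, _ => by simpa using one_mem_homog
  | n + 1, F, e, hF => by
    rw [List.ofFn_succ, List.prod_cons, Fin.sum_univ_succ]
    exact mul_mem_homog (hF 0) (prod_ofFn_mem_homog fun i => hF i.succ)

/-- A factor attached to the `j`-th factor of a product can be moved to the right end. -/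
theorem prod_ofFn_mul_right {J : Type*} [Fintype J] [LinearOrder J] {deg : J → ℤ}
    {h : GSeries K deg} {q : ℤ} (hh : h ∈ homog K deg q) :
    ∀ {n : ℕ} {F F' : Fin n → GSeries K deg} {e : Fin n → ℤ} {j : Fin n},
    (∀ i, j < i → F i ∈ homog K deg (e i)) → (∀ i, i ≠ j → F' i = F i) → F' j = F j * h →
    (List.ofFn F').prod = koszul K (q * ∑ i with j < i, e i) • ((List.ofFn F).prod * h)
  | 0, _, _, _, j, _, _, _ => j.elim0
  | n + 1, F, F', e, j, hF, hF', hj => by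
    rw [List.ofFn_succ, List.prod_cons, List.ofFn_succ, List.prod_cons, Finset.sum_filter,
      Fin.sum_univ_succ]
    rcases Fin.eq_zero_or_eq_succ j with rfl | ⟨j, rfl⟩
    · have e1 : (fun i : Fin n => F' i.succ) = fun i => F i.succ :=
        funext fun i => hF' _ (Fin.succ_ne_zero i)
      have e2 := mul_comm_of_mem_homog
        (prod_ofFn_mem_homog (e := fun i : Fin n => e i.succ) fun i => hF i.succ (Fin.succ_pos i)) hh
      rw [hj, e1, mul_assoc, mul_assoc, ← mul_smul_comm]
      congr 1
      simp only [lt_self_iff_false, if_false, zero_add, Fin.succ_pos, if_true]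
      rw [e2, mul_comm q]
    · rw [prod_ofFn_mul_right hh (F := fun i => F i.succ) (e := fun i => e i.succ) (j := j)
        (fun i hi => hF _ (Fin.succ_lt_succ_iff.2 hi))
        (fun i hi => hF' _ fun h => hi (Fin.succ_injective _ h)) hj,
        hF' 0 (Fin.succ_ne_zero j).symm, mul_smul_comm, mul_assoc]
      simp [Finset.sum_filter]

theorem sum_fin_succ_fun {α M : Type*} [Fintype α] [AddCommMonoid M] {n : ℕ}
    (F : (Fin (n + 1) → α) → M) : ∑ a, F a = ∑ b, ∑ a : Fin n → α, F (Fin.cons b a) := by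
  rw [← (Fin.consEquiv fun _ => α).sum_comp, Fintype.sum_prod_type]
  rfl

/-! ### The brackets on homogeneous functions -/

/-- The exponent `ε` of the brackets, for functions of degrees `d i`. -/
def coordSign (δ : ι → ℤ) {n : ℕ} (a : Fin n → ι) (d : Fin n → ℤ) : ℤ :=
  ∑ i : Fin n, coordDeg δ (a i) * ((∑ j with j < i, d j) + (i : ℕ))

omit [Fintype ι] [LinearOrder ι] in
theorem coordSign_cons {n : ℕ} (b : ι) (a : Fin n → ι) (d : Fin (n + 1) → ℤ) :
    coordSign δ (Fin.cons b a : Fin (n + 1) → ι) d =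
      coordSign δ a (fun i => d i.succ) + (1 + d 0) * ∑ i, coordDeg δ (a i) := by
  simp only [coordSign, Fin.sum_univ_succ, Finset.sum_filter, Fin.cons_zero, Fin.cons_succ]
  simp only [Fin.not_lt_zero, if_false, Finset.sum_const_zero, Fin.succ_pos, if_true,
    Fin.succ_lt_succ_iff, Fin.val_succ, Fin.val_zero, Finset.mul_sum]
  rw [← Finset.sum_add_distrib]
  simp only [Nat.cast_zero, add_zero, mul_zero, zero_add]
  refine Finset.sum_congr rfl fun i _ => ?_
  push_cast
  ring

omit [Fintype ι] [LinearOrder ι] in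
theorem coordSign_update {n : ℕ} (a : Fin n → ι) (d : Fin n → ℤ) (j : Fin n) (x : ℤ) :
    coordSign δ a (Function.update d j x) =
      coordSign δ a (Function.update d j 0) + x * ∑ i with j < i, coordDeg δ (a i) := by
  simp only [coordSign, Finset.sum_filter, Finset.mul_sum]
  rw [← Finset.sum_add_distrib]
  refine Finset.sum_congr rfl fun i _ => ?_
  have h : ∀ k, (if k < i then Function.update d j x k else 0) =
      (if k < i then Function.update d j 0 k else 0) + if k = j then if j < i then x else 0 else 0 := by
    intro k
    by_cases hk : k = j
    · subst hk
      simp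
    · simp [hk]
  rw [Finset.sum_congr rfl fun k _ => h k, Finset.sum_add_distrib, Finset.sum_ite_eq']
  simp only [Finset.mem_univ, if_true]
  split_ifs <;> ring

/-- The multidifferential operator `∑ (-1)^ε A^{a_1 … a_n}(t) (∂_{a_1} f_1) ⋯ (∂_{a_n} f_n)` for
functions `f i` of degree `d i`. -/
noncomputable def symbolSum (A : PolyVec K δ) {n : ℕ} (d : Fin n → ℤ)
    (f : Fin n → FunctionAlg K δ) : FunctionAlg K δ :=
  ∑ a : Fin n → ι, koszul K (coordSign δ a d) •
    (polyCoeff A a * (List.ofFn fun i => leftDeriv (a i) (f i)).prod)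

omit [Fintype ι] [LinearOrder ι] in
theorem parityPart_of_mem_homog {J : Type*} {deg : J → ℤ} {f : GSeries K deg} {d : ℤ}
    (hf : f ∈ homog K deg d) (p : ZMod 2) : parityPart p f = if (d : ZMod 2) = p then f else 0 := by
  ext m
  by_cases hm : monDegree deg m.1 = d
  · change (if ((monDegree deg m.1 : ℤ) : ZMod 2) = p then f.val m else 0) = _
    rw [hm]
    split_ifs <;> rfl
  · have h0 := hf m hm
    change (if ((monDegree deg m.1 : ℤ) : ZMod 2) = p then f.val m else 0) = _
    split_ifs <;> simp [h0, val_zero]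

theorem bracket_eq_symbolSum (Γ : PowerSeries (PolyVec K δ)) (k : ℕ) {n : ℕ} {d : Fin n → ℤ}
    {f : Fin n → FunctionAlg K δ} (hf : ∀ i, f i ∈ homog K (coordDeg δ) (d i)) :
    bracket Γ k n f = koszul K ((n - 1).choose 2) •
      symbolSum (PowerSeries.coeff (k - 1) Γ) d f := by
  simp only [bracket, smul_apply, sum_apply, symbolSum]
  congr 1
  refine Finset.sum_congr rfl fun a _ => ?_
  rw [Finset.sum_eq_single fun i => (d i : ZMod 2)]
  · have h1 : koszul K (bracketSign δ a fun i => (d i : ZMod 2)) = koszul K (coordSign δ a d) := by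
      refine koszul_congr K ?_
      simp only [bracketSign, coordSign]
      push_cast
      simp
    rw [h1]
    congr 1
    simp only [LinearMap.compMultilinearMap_apply, MultilinearMap.compLinearMap_apply,
      MultilinearMap.mkPiAlgebraFin_apply, LinearMap.mulLeft_apply, LinearMap.comp_apply]
    simp only [fun i => parityPart_of_mem_homog (hf i) (d i : ZMod 2), if_true]
  · intro p _ hp
    obtain ⟨i, hi⟩ := Function.ne_iff.1 hp
    simp only [LinearMap.compMultilinearMap_apply, MultilinearMap.compLinearMap_apply]
    rw [MultilinearMap.map_coord_zero _ i, map_zero, smul_zero]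
    rw [LinearMap.comp_apply, parityPart_of_mem_homog (hf i), if_neg (Ne.symm hi), map_zero]
  · intro h
    exact absurd (Finset.mem_univ _) h

/-! ### The Leibniz rule -/

/-- The Leibniz rule for the product of the derivatives `∂_{a_i} f_i`, in which the factor that is not
derived is moved to the right end. -/
theorem prod_leftDeriv_update {n : ℕ} (a : Fin n → ι) {d : Fin n → ℤ}
    {f : Fin n → FunctionAlg K δ} (hf : ∀ i, f i ∈ homog K (coordDeg δ) (d i)) {p q : ℤ}
    {g h : FunctionAlg K δ} (hg : g ∈ homog K (coordDeg δ) p) (hh : h ∈ homog K (coordDeg δ) q)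
    (j : Fin n) :
    (List.ofFn fun i => leftDeriv (a i) (Function.update f j (g * h) i)).prod =
      koszul K (q * ∑ i with j < i, (d i - coordDeg δ (a i))) •
        ((List.ofFn fun i => leftDeriv (a i) (Function.update f j g i)).prod * h) +
      koszul K (p * q + p * ∑ i with j < i, (d i - coordDeg δ (a i))) •
        ((List.ofFn fun i => leftDeriv (a i) (Function.update f j h i)).prod * g) := by
  set F : Fin n → FunctionAlg K δ := fun i => leftDeriv (a i) (f i) with hFdef
  have hF : ∀ i, F i ∈ homog K (coordDeg δ) (d i - coordDeg δ (a i)) :=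
    fun i => leftDeriv_mem_homog _ (hf i)
  have hu : ∀ x : FunctionAlg K δ, (fun i => leftDeriv (a i) (Function.update f j x i)) =
      Function.update F j (leftDeriv (a j) x) :=
    fun x => funext fun i => Function.apply_update (fun i => leftDeriv (a i)) f j x i
  have hmove : ∀ {x y : FunctionAlg K δ} {r : ℤ}, y ∈ homog K (coordDeg δ) r →
      (List.ofFn (Function.update F j (x * y))).prod =
        koszul K (r * ∑ i with j < i, (d i - coordDeg δ (a i))) •
          ((List.ofFn (Function.update F j x)).prod * y) := by
    intro x y r hy
    refine prod_ofFn_mul_right hy (fun i hi => ?_) (fun i hi => ?_) ?_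
    · rw [Function.update_of_ne hi.ne']
      exact hF i
    · rw [Function.update_of_ne hi, Function.update_of_ne hi]
    · rw [Function.update_self, Function.update_self]
  rw [hu, hu, hu, leftDeriv_mul _ hg,
    mul_comm_of_mem_homog (leftDeriv_mem_homog (a j) hh) hg, smul_smul, ← koszul_add]
  have hadd := (MultilinearMap.mkPiAlgebraFin K n (FunctionAlg K δ)).map_update_add F j
    (leftDeriv (a j) g * h)
    (koszul K (coordDeg δ (a j) * p + (q - coordDeg δ (a j)) * p) • (leftDeriv (a j) h * g))
  rw [MultilinearMap.map_update_smul] at hadd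
  simp only [MultilinearMap.mkPiAlgebraFin_apply] at hadd
  rw [hadd, hmove hh, hmove hg, koszul_smul_smul]
  congr 2
  congr 1
  ring

theorem bracket_leibniz (Γ : PowerSeries (PolyVec K δ)) (k : ℕ) {n : ℕ} {d : Fin n → ℤ}
    {f : Fin n → FunctionAlg K δ} (hf : ∀ i, f i ∈ homog K (coordDeg δ) (d i)) {p q : ℤ}
    {g h : FunctionAlg K δ} (hg : g ∈ homog K (coordDeg δ) p) (hh : h ∈ homog K (coordDeg δ) q)
    (j : Fin n) :
    bracket Γ k n (Function.update f j (g * h)) =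
      koszul K (p * (q + ∑ i with j < i, d i)) • (bracket Γ k n (Function.update f j h) * g) +
      koszul K (q * ∑ i with j < i, d i) • (bracket Γ k n (Function.update f j g) * h) := by
  have hup : ∀ {x : FunctionAlg K δ} {r : ℤ}, x ∈ homog K (coordDeg δ) r →
      ∀ i, Function.update f j x i ∈ homog K (coordDeg δ) (Function.update d j r i) := by
    intro x r hx i
    by_cases hi : i = j
    · subst hi
      simpa using hx
    · simpa [hi] using hf i
  rw [bracket_eq_symbolSum Γ k (hup (mul_mem_homog hg hh)), bracket_eq_symbolSum Γ k (hup hg),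
    bracket_eq_symbolSum Γ k (hup hh), smul_mul_assoc, smul_mul_assoc,
    smul_comm _ (koszul K ((n - 1).choose 2)), smul_comm _ (koszul K ((n - 1).choose 2)), ← smul_add]
  congr 1
  simp only [symbolSum, Finset.sum_mul, Finset.smul_sum]
  rw [← Finset.sum_add_distrib]
  refine Finset.sum_congr rfl fun a _ => ?_
  rw [prod_leftDeriv_update a hf hg hh j, mul_add, smul_add, add_comm, mul_smul_comm, mul_smul_comm,
    koszul_smul_smul, koszul_smul_smul, smul_mul_assoc, smul_mul_assoc, koszul_smul_smul,
    koszul_smul_smul, mul_assoc, mul_assoc, coordSign_update a d j (p + q), coordSign_update a d j p,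
    coordSign_update a d j q, Finset.sum_sub_distrib]
  congr 2 <;>
  · refine koszul_congr K ?_
    simp only [Int.cast_add, Int.cast_mul, Int.cast_sub]
    generalize ((coordSign δ a (Function.update d j 0) : ℤ) : ZMod 2) = w
    generalize ((∑ i with j < i, coordDeg δ (a i) : ℤ) : ZMod 2) = x
    generalize ((∑ i with j < i, d i : ℤ) : ZMod 2) = y
    generalize (p : ZMod 2) = p
    generalize (q : ZMod 2) = q
    revert w x y p q
    decide

/-! ### Iterated brackets with functions -/

/-- The iterated bracket `(⋯ (A • f_n) • ⋯) • f_1`. -/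
noncomputable def iterBullet (A : PolyVec K δ) (L : List (FunctionAlg K δ)) : PolyVec K δ :=
  L.foldr (fun f X => bullet X (incl f)) A

theorem iterBullet_cons (A : PolyVec K δ) (f : FunctionAlg K δ) (L : List (FunctionAlg K δ)) :
    iterBullet A (f :: L) = bullet (iterBullet A L) (incl f) := rfl

theorem iterBullet_add (A B : PolyVec K δ) (L : List (FunctionAlg K δ)) :
    iterBullet (A + B) L = iterBullet A L + iterBullet B L := by
  induction L with
  | nil => rfl
  | cons f L ih => rw [iterBullet_cons, ih, bullet_add_left, iterBullet_cons, iterBullet_cons]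

theorem iterBullet_zero (L : List (FunctionAlg K δ)) :
    iterBullet (0 : PolyVec K δ) L = 0 := by
  induction L with
  | nil => rfl
  | cons f L ih => rw [iterBullet_cons, ih, bullet_zero_left]

theorem iterBullet_mem_homog {A : PolyVec K δ} {p : ℤ} (hA : A ∈ homog K (polyDeg δ) p) {α : Type*}
    {f : α → FunctionAlg K δ} {d : α → ℤ} (hf : ∀ i, f i ∈ homog K (coordDeg δ) (d i))
    (I : List α) :
    iterBullet A (I.map f) ∈ homog K (polyDeg δ) (p + (I.map fun i => d i - 1).sum) := by
  induction I with
  | nil => simpa [iterBullet] using hA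
  | cons i I ih =>
    have h := bullet_mem_homog ih (incl_mem_homog (hf i))
    simp only [List.map_cons, List.sum_cons, iterBullet_cons]
    have e : p + (d i - 1 + (I.map fun i => d i - 1).sum) =
      p + (I.map fun i => d i - 1).sum + d i - 1 := by ring
    rwa [e]

/-- The exponent `∑_{i < j} (1 + d_i) d_j` of the sign that compares the brackets with the iterated
Schouten brackets. -/
def decalage : List ℤ → ℤ
  | [] => 0
  | d :: L => (1 + d) * L.sum + decalage L

theorem foldr_rightDeriv_mem_homog {A : PolyVec K δ} {p : ℤ} (hA : A ∈ homog K (polyDeg δ) p) :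
    ∀ L : List ι, L.foldr (fun b X => rightDeriv (Sum.inrₗ b) X) A ∈
      homog K (polyDeg δ) (p - (L.map fun b => 1 - coordDeg δ b).sum)
  | [] => by simpa using hA
  | b :: L => by
    have h := rightDeriv_mem_homog (Sum.inrₗ b) (foldr_rightDeriv_mem_homog hA L)
    rw [List.foldr_cons, List.map_cons, List.sum_cons]
    rw [polyDeg_inr] at h
    have e : p - (1 - coordDeg δ b + (L.map fun b => 1 - coordDeg δ b).sum) =
      p - (L.map fun b => 1 - coordDeg δ b).sum - (1 - coordDeg δ b) := by ring
    rwa [e]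

theorem rightDeriv_one {J : Type*} [Fintype J] [LinearOrder J] {deg : J → ℤ} (j : J) :
    rightDeriv j (1 : GSeries K deg) = 0 := by
  refine ext_coeff fun m => ?_
  rw [coeff_rightDeriv, coeff_one, if_neg, mul_zero, mul_zero, map_zero]
  intro h
  have := DFunLike.congr_fun h j
  simp at this

theorem rightDeriv_prod_incl (b : ι) : ∀ {n : ℕ} {F : Fin n → FunctionAlg K δ} {e : Fin n → ℤ},
    (∀ i, F i ∈ homog K (coordDeg δ) (e i)) →
    rightDeriv (Sum.inrₗ b) (List.ofFn fun i => incl (F i)).prod = 0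
  | 0, _, _, _ => by simpa using rightDeriv_one _
  | n + 1, F, e, hF => by
    rw [List.ofFn_succ, List.prod_cons, rightDeriv_mul _ (incl_mem_homog (hF 0))
      (prod_ofFn_mem_homog fun i : Fin n => incl_mem_homog (hF i.succ)),
      rightDeriv_prod_incl b fun i => hF i.succ, rightDeriv_incl, mul_zero, zero_mul, smul_zero,
      add_zero]

/-- The iterated bracket as a multidifferential operator. Induction on the number of functions: the
right derivative of the outermost bracket passes the derivatives `∂_{a_i} f_i`, which do not contain
`ψ`, and the new factor `∂_b f` is moved in front of them. -/
theorem iterBullet_ofFn {A : PolyVec K δ} {p : ℤ} (hA : A ∈ homog K (polyDeg δ) p) :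
    ∀ {n : ℕ} {d : Fin n → ℤ} {f : Fin n → FunctionAlg K δ},
    (∀ i, f i ∈ homog K (coordDeg δ) (d i)) →
    iterBullet A (List.ofFn f) = koszul K (decalage (List.ofFn d)) •
      ∑ a : Fin n → ι, koszul K (coordSign δ a d) •
        ((List.ofFn a).foldr (fun b X => rightDeriv (Sum.inrₗ b) X) A *
          (List.ofFn fun i => incl (leftDeriv (a i) (f i))).prod)
  | 0, d, f, _ => by
    simp [decalage, koszul_zero, coordSign, iterBullet]
  | n + 1, d, f, hf => by
    rw [List.ofFn_succ, iterBullet_cons, iterBullet_ofFn hA fun i => hf i.succ, bullet_smul_left,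
      sum_fin_succ_fun, bullet, List.ofFn_succ, decalage, Finset.smul_sum, Finset.smul_sum]
    refine Finset.sum_congr rfl fun b _ => ?_
    rw [map_sum, Finset.sum_mul, Finset.smul_sum, Finset.smul_sum]
    refine Finset.sum_congr rfl fun a _ => ?_
    have hd : ∀ i : Fin n, leftDeriv (a i) (f i.succ) ∈
        homog K (coordDeg δ) (d i.succ - coordDeg δ (a i)) := fun i => leftDeriv_mem_homog _ (hf _)
    have hQ := prod_ofFn_mem_homog fun i => incl_mem_homog (hd i)
    have hb := incl_mem_homog (leftDeriv_mem_homog b (hf 0))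
    rw [map_smul, rightDeriv_mul _ (foldr_rightDeriv_mem_homog hA _) hQ, rightDeriv_prod_incl b hd,
      mul_zero, zero_add, leftDeriv_incl, smul_mul_assoc, smul_mul_assoc, mul_assoc,
      mul_comm_of_mem_homog hb hQ, mul_smul_comm, coordSign_cons]
    simp only [List.ofFn_succ, Fin.cons_zero, Fin.cons_succ, List.foldr_cons, List.prod_cons,
      koszul_smul_smul]
    congr 1
    refine koszul_congr K ?_
    rw [polyDeg_inr, Finset.sum_sub_distrib, List.sum_ofFn]
    simp only [Int.cast_add, Int.cast_mul, Int.cast_sub]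
    generalize ((coordSign δ a fun i => d i.succ : ℤ) : ZMod 2) = w
    generalize ((∑ i, coordDeg δ (a i) : ℤ) : ZMod 2) = x
    generalize ((∑ i : Fin n, d i.succ : ℤ) : ZMod 2) = y
    generalize ((coordDeg δ b : ℤ) : ZMod 2) = b
    generalize ((d 0 : ℤ) : ZMod 2) = e
    generalize ((decalage (List.ofFn fun i : Fin n => d i.succ) : ℤ) : ZMod 2) = t
    revert w x y b e t
    decide

theorem setPsiZero_list_prod (L : List (PolyVec K δ)) :
    setPsiZero L.prod = (L.map setPsiZero).prod := by
  induction L with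
  | nil => exact setPsiZero_one
  | cons A L ih => rw [List.prod_cons, setPsiZero_mul, ih, List.map_cons, List.prod_cons]

theorem setPsiZero_iterBullet {A : PolyVec K δ} {p : ℤ} (hA : A ∈ homog K (polyDeg δ) p) {n : ℕ}
    {d : Fin n → ℤ} {f : Fin n → FunctionAlg K δ} (hf : ∀ i, f i ∈ homog K (coordDeg δ) (d i)) :
    setPsiZero (iterBullet A (List.ofFn f)) =
      koszul K (decalage (List.ofFn d)) • symbolSum A d f := by
  rw [iterBullet_ofFn hA hf, setPsiZero_smul, setPsiZero_sum, symbolSum]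
  simp only [setPsiZero_smul, setPsiZero_mul, setPsiZero_list_prod, List.map_ofFn]
  simp only [Function.comp_def, setPsiZero_incl]
  rfl

/-- The brackets are the iterated Schouten brackets with functions, restricted to `ψ = 0`. -/
theorem bracket_eq_iterBullet {Γ : PowerSeries (PolyVec K δ)} {p : ℤ} (hΓ : HasDegree Γ p) (k : ℕ)
    {n : ℕ} {d : Fin n → ℤ} {f : Fin n → FunctionAlg K δ}
    (hf : ∀ i, f i ∈ homog K (coordDeg δ) (d i)) :
    bracket Γ k n f = koszul K ((n - 1).choose 2 + decalage (List.ofFn d)) •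
      setPsiZero (iterBullet (PowerSeries.coeff (k - 1) Γ) (List.ofFn f)) := by
  rw [setPsiZero_iterBullet (hΓ _) hf, bracket_eq_symbolSum Γ k hf, koszul_smul_smul, add_assoc,
    koszul_add K ((n - 1).choose 2 : ℤ), koszul_of_even K (n := decalage _ + _) ⟨_, rfl⟩, mul_one]

theorem symbolSum_mem_homog {A : PolyVec K δ} {n : ℕ} {D : ℤ}
    (hA : ∀ a : Fin n → ι, polyCoeff A a ∈ homog K (coordDeg δ) (D - ∑ i, (1 - coordDeg δ (a i))))
    {d : Fin n → ℤ} {f : Fin n → FunctionAlg K δ} (hf : ∀ i, f i ∈ homog K (coordDeg δ) (d i)) :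
    symbolSum A d f ∈ homog K (coordDeg δ) ((∑ i, d i) + D - n) := by
  refine Submodule.sum_mem _ fun a _ => Submodule.smul_mem _ _ ?_
  have h := mul_mem_homog (hA a) (prod_ofFn_mem_homog fun i => leftDeriv_mem_homog (a i) (hf i))
  have e : (∑ i, d i) + D - n =
      D - ∑ i, (1 - coordDeg δ (a i)) + ∑ i, (d i - coordDeg δ (a i)) := by
    simp only [Finset.sum_sub_distrib, Finset.sum_const, Finset.card_univ, Fintype.card_fin,
      nsmul_eq_mul]
    ring
  rwa [e]

theorem polyCoeff_mem_homog {A : PolyVec K δ} {D : ℤ} (hA : A ∈ homog K (polyDeg δ) D) {n : ℕ}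
    (a : Fin n → ι) :
    polyCoeff A a ∈ homog K (coordDeg δ) (D - ∑ i, (1 - coordDeg δ (a i))) := by
  have h := setPsiZero_mem_homog (foldr_rightDeriv_mem_homog hA (List.ofFn a))
  rwa [List.map_ofFn, List.sum_ofFn] at h

theorem bracket_mem_homog {Γ : PowerSeries (PolyVec K δ)} {D : ℤ} (hΓ : HasDegree Γ D) (k : ℕ)
    {n : ℕ} {d : Fin n → ℤ} {f : Fin n → FunctionAlg K δ}
    (hf : ∀ i, f i ∈ homog K (coordDeg δ) (d i)) :
    bracket Γ k n f ∈ homog K (coordDeg δ) ((∑ i, d i) + D - n) := by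
  rw [bracket_eq_symbolSum Γ k hf]
  exact Submodule.smul_mem _ _ (symbolSum_mem_homog (fun a => polyCoeff_mem_homog (hΓ _) a) hf)

theorem bracket_leibniz_left {Γ : PowerSeries (PolyVec K δ)} {D : ℤ} (hΓ : HasDegree Γ D) (k : ℕ)
    {n : ℕ} {d : Fin n → ℤ} {f : Fin n → FunctionAlg K δ}
    (hf : ∀ i, f i ∈ homog K (coordDeg δ) (d i)) {p q : ℤ}
    {g h : FunctionAlg K δ} (hg : g ∈ homog K (coordDeg δ) p) (hh : h ∈ homog K (coordDeg δ) q)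
    (j : Fin n) :
    bracket Γ k n (Function.update f j (g * h)) =
      koszul K (p * (D - n + ∑ i with i < j, d i)) •
        (g * bracket Γ k n (Function.update f j h)) +
      koszul K (q * ∑ i with j < i, d i) • (bracket Γ k n (Function.update f j g) * h) := by
  have hup : ∀ i, Function.update f j h i ∈ homog K (coordDeg δ) (Function.update d j q i) := by
    intro i
    by_cases hi : i = j
    · subst hi
      simpa using hh
    · simpa [hi] using hf i
  rw [bracket_leibniz Γ k hf hg hh j, mul_comm_of_mem_homog hg (bracket_mem_homog hΓ k hup),
    koszul_smul_smul]
  congr 2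
  refine koszul_congr K ?_
  have hs : ∑ i, Function.update d j q i = (∑ i with i < j, d i) + q + ∑ i with j < i, d i := by
    rw [sum_eq_sum_lt_add j, Function.update_self]
    refine congrArg₂ (· + ·) (congrArg (· + q) ?_) ?_
    · refine Finset.sum_congr rfl fun i hi => ?_
      rw [Function.update_of_ne (Finset.mem_filter.1 hi).2.ne]
    · refine Finset.sum_congr rfl fun i hi => ?_
      rw [Function.update_of_ne (Finset.mem_filter.1 hi).2.ne']
  rw [hs]
  simp only [Int.cast_add, Int.cast_mul, Int.cast_sub]
  generalize ((∑ i with i < j, d i : ℤ) : ZMod 2) = x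
  generalize ((∑ i with j < i, d i : ℤ) : ZMod 2) = y
  generalize (p : ZMod 2) = p
  generalize (q : ZMod 2) = q
  generalize (D : ZMod 2) = D
  generalize (((n : ℕ) : ℤ) : ZMod 2) = n
  revert x y p q D n
  decide

end Iterated

section Splits

open GSeries

variable {K : Type*} [Field K] {ι : Type*} [Fintype ι] [LinearOrder ι] {δ : ι → ℤ}

/-! ### Splitting the arguments -/

/-- The indices `i` with `c i = b`, in increasing order. A map `c : Fin n → Bool` encodes a
splitting of `n` arguments into those that go into the inner bracket (`true`) and the outer bracket
(`false`). -/
def part {n : ℕ} (c : Fin n → Bool) (b : Bool) : List (Fin n) :=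
  (List.finRange n).filter fun i => c i == b

theorem part_cons_self {n : ℕ} (b : Bool) (c : Fin n → Bool) :
    part (Fin.cons b c : Fin (n + 1) → Bool) b = 0 :: (part c b).map Fin.succ := by
  rw [part, List.finRange_succ, List.filter_cons_of_pos (by simp), List.filter_map]
  rfl

theorem part_cons_of_ne {n : ℕ} {b b' : Bool} (h : b ≠ b') (c : Fin n → Bool) :
    part (Fin.cons b c : Fin (n + 1) → Bool) b' = (part c b').map Fin.succ := by
  rw [part, List.finRange_succ, List.filter_cons_of_neg (by simpa using h), List.filter_map]
  rfl

theorem part_not {n : ℕ} (c : Fin n → Bool) (b : Bool) : part (fun i => !c i) b = part c (!b) := by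
  rw [part, part]
  congr 1
  funext i
  cases c i <;> cases b <;> rfl

theorem sum_map_part {n : ℕ} (c : Fin n → Bool) (b : Bool) (g : Fin n → ℤ) :
    ((part c b).map g).sum = ∑ i, if c i = b then g i else 0 := by
  have h : ∀ L : List (Fin n), ((L.filter fun i => c i == b).map g).sum =
      (L.map fun i => if c i = b then g i else 0).sum := by
    intro L
    induction L with
    | nil => rfl
    | cons i L ih =>
      by_cases hi : c i = b
      · simp [hi, ih]
      · simp [hi, ih]
  rw [part, h, ← List.ofFn_eq_map, List.sum_ofFn]

/-- The exponent of the sign with which a splitting contributes to the iterated bracket of `[A, B]`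
with functions of degrees `d i`, where `B` has degree `q`: every argument of `A` passes `B` and the
arguments of `B` to its right. -/
def splitSign {n : ℕ} (q : ℤ) (d : Fin n → ℤ) (c : Fin n → Bool) : ℤ :=
  ∑ j, (if c j = false then 1 + d j else 0) *
    (1 + q + ∑ i with j < i, if c i = true then 1 + d i else 0)

theorem splitSign_cons {n : ℕ} (q : ℤ) (d : Fin (n + 1) → ℤ) (b : Bool) (c : Fin n → Bool) :
    splitSign q d (Fin.cons b c : Fin (n + 1) → Bool) =
      (if b = false then 1 + d 0 else 0) * (1 + q + ∑ i, if c i = true then 1 + d i.succ else 0) +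
        splitSign q (fun i => d i.succ) c := by
  simp only [splitSign, Fin.sum_univ_succ, Finset.sum_filter, Fin.cons_zero, Fin.cons_succ]
  simp

omit [Fintype ι] [LinearOrder ι] in
theorem cast_sum_part {n : ℕ} (c : Fin n → Bool) (b : Bool) (d : Fin n → ℤ) :
    ((((part c b).map fun i => d i - 1).sum : ℤ) : ZMod 2) =
      ((∑ i, if c i = b then 1 + d i else 0 : ℤ) : ZMod 2) := by
  rw [sum_map_part, Int.cast_sum, Int.cast_sum]
  refine Finset.sum_congr rfl fun i _ => ?_
  split_ifs
  · push_cast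
    generalize ((d i : ℤ) : ZMod 2) = x
    revert x
    decide
  · rfl

/-- The iterated bracket of `[A, B]` with functions distributes over the two factors. -/
theorem iterBullet_homogBracket {A B : PolyVec K δ} {p q : ℤ} (hA : A ∈ homog K (polyDeg δ) p)
    (hB : B ∈ homog K (polyDeg δ) q) :
    ∀ {n : ℕ} {d : Fin n → ℤ} {f : Fin n → FunctionAlg K δ},
    (∀ i, f i ∈ homog K (coordDeg δ) (d i)) →
    iterBullet (homogBracket p q A B) (List.ofFn f) =
      ∑ c : Fin n → Bool, koszul K (splitSign q d c) •
        homogBracket (p + ((part c false).map fun i => d i - 1).sum)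
          (q + ((part c true).map fun i => d i - 1).sum)
          (iterBullet A ((part c false).map f)) (iterBullet B ((part c true).map f))
  | 0, d, f, _ => by
    simp [iterBullet, part, splitSign, koszul_zero]
  | n + 1, d, f, hf => by
    have hbs : ∀ (s : Finset (Fin n → Bool)) (X : (Fin n → Bool) → PolyVec K δ) (Y : PolyVec K δ),
        bullet (∑ c ∈ s, X c) Y = ∑ c ∈ s, bullet (X c) Y := by
      intro s X Y
      simp only [bullet, map_sum, Finset.sum_mul]
      exact Finset.sum_comm
    rw [List.ofFn_succ, iterBullet_cons, iterBullet_homogBracket hA hB fun i => hf i.succ, hbs,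
      sum_fin_succ_fun, Fintype.sum_bool, ← Finset.sum_add_distrib]
    refine Finset.sum_congr rfl fun c _ => ?_
    have hf' : ∀ i : Fin n, (fun i : Fin n => f i.succ) i ∈
      homog K (coordDeg δ) ((fun i : Fin n => d i.succ) i) := fun i => hf i.succ
    rw [bullet_smul_left, homogBracket_bullet (iterBullet_mem_homog hA hf' _)
      (iterBullet_mem_homog hB hf' _) (incl_mem_homog (hf 0))
      (fun a => rightDeriv_incl a _), smul_add, koszul_smul_smul]
    rw [part_cons_self, part_cons_self, part_cons_of_ne (by decide), part_cons_of_ne (by decide)]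
    simp only [List.map_cons, List.map_map, List.sum_cons, iterBullet_cons, splitSign_cons]
    have e1 : ∀ x y : ℤ, x + y + d 0 - 1 = x + (d 0 - 1 + y) := fun x y => by ring
    rw [e1, e1]
    congr 2
    · congr 1
      simp
    · refine koszul_congr K ?_
      have h := cast_sum_part c true fun i => d i.succ
      simp only [Int.cast_add, Int.cast_mul, if_true, h]
      ring

/-- The sign of a splitting in the second half `± B • A` of the Schouten bracket is the sign of the
complementary splitting. -/
theorem splitSign_not {n : ℕ} {p q : ℤ} (hp : Even p) (hq : Even q) (d : Fin n → ℤ)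
    (c : Fin n → Bool) :
    koszul K (splitSign q d c + ((p + ((part c false).map fun i => d i - 1).sum) *
        (q + ((part c true).map fun i => d i - 1).sum) +
        (p + ((part c false).map fun i => d i - 1).sum) +
        (q + ((part c true).map fun i => d i - 1).sum))) =
      koszul K (splitSign 0 d fun i => !c i) := by
  have hp0 : (p : ZMod 2) = 0 := by
    rw [ZMod.intCast_zmod_eq_zero_iff_dvd]
    exact even_iff_two_dvd.1 hp
  have hq0 : (q : ZMod 2) = 0 := by
    rw [ZMod.intCast_zmod_eq_zero_iff_dvd]
    exact even_iff_two_dvd.1 hq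
  have key : ∀ u w : Fin n → ℤ, (∀ i, w i * u i = 0) →
      (∑ j, w j) * ∑ i, u i =
        (∑ j, w j * ∑ i with j < i, u i) + ∑ j, u j * ∑ i with j < i, w i := by
    intro u w huw
    have h2 : ∑ j, u j * ∑ i with j < i, w i = ∑ j, w j * ∑ i with i < j, u i := by
      simp only [Finset.sum_filter, Finset.mul_sum]
      rw [Finset.sum_comm]
      refine Finset.sum_congr rfl fun i _ => Finset.sum_congr rfl fun j _ => ?_
      split_ifs <;> ring
    rw [h2, Finset.sum_mul, ← Finset.sum_add_distrib]
    refine Finset.sum_congr rfl fun j _ => ?_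
    rw [sum_eq_sum_lt_add j, mul_add, mul_add, huw]
    ring
  have hk := key (fun i => if c i = true then 1 + d i else 0)
    (fun i => if c i = false then 1 + d i else 0) fun i => by cases c i <;> simp
  refine koszul_congr K ?_
  rw [Int.cast_add, Int.cast_add, Int.cast_add, Int.cast_mul, Int.cast_add p, Int.cast_add q,
    cast_sum_part, cast_sum_part]
  have hs : splitSign q d c = (1 + q) * (∑ j, if c j = false then 1 + d j else 0) +
      ∑ j, (if c j = false then 1 + d j else 0) *
        ∑ i with j < i, if c i = true then 1 + d i else 0 := by
    rw [splitSign, Finset.mul_sum, ← Finset.sum_add_distrib]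
    exact Finset.sum_congr rfl fun j _ => by ring
  have hs' : (splitSign 0 d fun i => !c i) = (∑ j, if c j = true then 1 + d j else 0) +
      ∑ j, (if c j = true then 1 + d j else 0) *
        ∑ i with j < i, if c i = false then 1 + d i else 0 := by
    rw [splitSign, ← Finset.sum_add_distrib]
    simp only [Bool.not_eq_false', Bool.not_eq_true']
    exact Finset.sum_congr rfl fun j _ => by ring
  rw [hs, hs', hp0, Int.cast_add, Int.cast_add, Int.cast_mul, Int.cast_add 1 q, hq0]
  have hk2 := congrArg (Int.cast : ℤ → ZMod 2) hk
  rw [Int.cast_mul, Int.cast_add] at hk2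
  revert hk2
  generalize ((∑ j, if c j = false then 1 + d j else 0 : ℤ) : ZMod 2) = x
  generalize ((∑ j, if c j = true then 1 + d j else 0 : ℤ) : ZMod 2) = y
  generalize ((∑ j, (if c j = true then 1 + d j else 0) *
    ∑ i with j < i, if c i = false then 1 + d i else 0 : ℤ) : ZMod 2) = z
  generalize ((∑ j, (if c j = false then 1 + d j else 0) *
    ∑ i with j < i, if c i = true then 1 + d i else 0 : ℤ) : ZMod 2) = w
  simp only [Int.cast_one]
  revert x y z w
  decide

/-- The sum over all splittings of the compositions of the multibrackets of `A` and `B`, in which the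
value of the inner bracket is the first argument of the outer one. -/
noncomputable def nestedSum (A B : PolyVec K δ) {n : ℕ} (d : Fin n → ℤ)
    (f : Fin n → FunctionAlg K δ) : FunctionAlg K δ :=
  ∑ c : Fin n → Bool, koszul K (splitSign 0 d c) •
    setPsiZero (iterBullet A
      (setPsiZero (iterBullet B ((part c true).map f)) :: (part c false).map f))

/-- The derived bracket formula: the compositions of the multibrackets of `A` and `B` add up to the
multibracket of `[A, B]`. -/
theorem setPsiZero_iterBullet_homogBracket {A B : PolyVec K δ} {p q : ℤ} (hp : Even p) (hq : Even q)
    (hA : A ∈ homog K (polyDeg δ) p) (hB : B ∈ homog K (polyDeg δ) q) {n : ℕ} {d : Fin n → ℤ}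
    {f : Fin n → FunctionAlg K δ} (hf : ∀ i, f i ∈ homog K (coordDeg δ) (d i)) :
    setPsiZero (iterBullet (homogBracket p q A B) (List.ofFn f)) =
      nestedSum A B d f + nestedSum B A d f := by
  have h2 : nestedSum B A d f = ∑ c : Fin n → Bool, koszul K (splitSign 0 d fun i => !c i) •
      setPsiZero (iterBullet B
        (setPsiZero (iterBullet A ((part c false).map f)) :: (part c true).map f)) := by
    rw [nestedSum, ← (Equiv.arrowCongr (Equiv.refl (Fin n)) Equiv.boolNot).sum_comp]
    refine Finset.sum_congr rfl fun c _ => ?_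
    have e : (Equiv.arrowCongr (Equiv.refl (Fin n)) Equiv.boolNot) c = fun i => !c i := rfl
    rw [e, part_not, part_not]
    rfl
  rw [iterBullet_homogBracket hA hB hf, setPsiZero_sum, h2, nestedSum, ← Finset.sum_add_distrib]
  refine Finset.sum_congr rfl fun c _ => ?_
  have hq0 : koszul K (splitSign q d c) = koszul K (splitSign 0 d c) := by
    refine koszul_congr K ?_
    have hq0 : (q : ZMod 2) = 0 := by
      rw [ZMod.intCast_zmod_eq_zero_iff_dvd]
      exact even_iff_two_dvd.1 hq
    simp only [splitSign, Int.cast_sum, Int.cast_mul, Int.cast_add, hq0, Int.cast_zero]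
  rw [homogBracket, smul_add, koszul_smul_smul, setPsiZero_add, setPsiZero_smul, setPsiZero_smul,
    splitSign_not hp hq, hq0, setPsiZero_bullet, setPsiZero_bullet (iterBullet B _)]
  rfl

end Splits

section Unshuffles

/-! ### Inversions of permutations -/

theorem sum_lt_symm_comp {n : ℕ} (S : Fin n → Fin n → ℤ) (hS : ∀ i j, S i j = S j i)
    (σ : Equiv.Perm (Fin n)) :
    ∑ i, ∑ j with i < j, S (σ i) (σ j) = ∑ i, ∑ j with i < j, S i j := by
  have h : ∀ T : Fin n → Fin n → ℤ, (∀ i j, T i j = T j i) →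
      2 * ∑ i, ∑ j with i < j, T i j = ∑ i, ∑ j, T i j - ∑ i, T i i := by
    intro T hT
    have h1 : ∑ i, ∑ j with j < i, T i j = ∑ i, ∑ j with i < j, T i j := by
      simp only [Finset.sum_filter]
      rw [Finset.sum_comm]
      exact Finset.sum_congr rfl fun i _ => Finset.sum_congr rfl fun j _ => by rw [hT]
    have h2 : ∑ i, ∑ j, T i j =
        ∑ i, ((∑ j with j < i, T i j) + T i i + ∑ j with i < j, T i j) :=
      Finset.sum_congr rfl fun i _ => GSeries.sum_eq_sum_lt_add i _
    rw [h2, Finset.sum_add_distrib, Finset.sum_add_distrib, h1]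
    ring
  have h1 := h (fun i j => S (σ i) (σ j)) fun i j => hS _ _
  have h2 := h S hS
  have h3 : ∑ i, ∑ j, S (σ i) (σ j) = ∑ i, ∑ j, S i j := by
    rw [← Equiv.sum_comp σ fun i => ∑ j, S i j]
    exact Finset.sum_congr rfl fun i _ => Equiv.sum_comp σ fun j => S (σ i) j
  have h4 : ∑ i, S (σ i) (σ i) = ∑ i, S i i := Equiv.sum_comp σ fun i => S i i
  rw [h3, h4] at h1
  linarith

/-- A sum over the ordered pairs of places changes under a permutation of the places by the
contributions of the inversions. -/
theorem sum_lt_comp {n : ℕ} (G : Fin n → Fin n → ℤ) (σ : Equiv.Perm (Fin n)) :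
    ∑ i, ∑ j with i < j, G (σ i) (σ j) = (∑ i, ∑ j with i < j, G i j) +
      ∑ i, ∑ j with i < j ∧ σ j < σ i, (G (σ i) (σ j) - G (σ j) (σ i)) := by
  have h := sum_lt_symm_comp (fun i j => if i < j then G i j else G j i)
    (fun i j => ?_) σ
  · have h1 : ∑ i, ∑ j with i < j, (if i < j then G i j else G j i) =
        ∑ i, ∑ j with i < j, G i j :=
      Finset.sum_congr rfl fun i _ => Finset.sum_congr rfl fun j hj =>
        if_pos (Finset.mem_filter.1 hj).2
    rw [h1] at h
    rw [← h, ← Finset.sum_add_distrib]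
    refine Finset.sum_congr rfl fun i _ => ?_
    rw [Finset.sum_filter, Finset.sum_filter, Finset.sum_filter, ← Finset.sum_add_distrib]
    refine Finset.sum_congr rfl fun j _ => ?_
    by_cases hij : i < j
    · rcases lt_trichotomy (σ i) (σ j) with hs | hs | hs
      · simp [hij, hs, hs.not_gt]
      · exact absurd (σ.injective hs) hij.ne
      · simp [hij, hs, hs.not_gt]
    · simp [hij]
  · rcases lt_trichotomy i j with hs | rfl | hs
    · simp [hs, hs.not_gt]
    · rfl
    · simp [hs, hs.not_gt]

theorem decalage_ofFn : ∀ {n : ℕ} (d : Fin n → ℤ),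
    decalage (List.ofFn d) = ∑ i, ∑ j with i < j, (1 + d i) * d j
  | 0, _ => by simp [decalage]
  | n + 1, d => by
    rw [List.ofFn_succ, decalage, decalage_ofFn, List.sum_ofFn]
    simp only [Finset.sum_filter, Fin.sum_univ_succ, Finset.mul_sum]
    simp

theorem decalage_append (L M : List ℤ) :
    decalage (L ++ M) = decalage L + decalage M + (L.length + L.sum) * M.sum := by
  induction L with
  | nil => simp [decalage]
  | cons d L ih =>
    simp only [List.cons_append, decalage, ih, List.sum_append, List.length_cons, List.sum_cons]
    push_cast
    ring

/-- Under a permutation the décalage sign changes by `(-1)^(d + d')` for each inversion. -/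
theorem decalage_ofFn_comp {n : ℕ} (d : Fin n → ℤ) (σ : Equiv.Perm (Fin n)) :
    ((decalage (List.ofFn fun i => d (σ i)) : ℤ) : ZMod 2) =
      ((decalage (List.ofFn d) + ∑ i, ∑ j with i < j ∧ σ j < σ i, (d (σ i) + d (σ j)) : ℤ) :
        ZMod 2) := by
  rw [decalage_ofFn, decalage_ofFn, sum_lt_comp (fun i j => (1 + d i) * d j), Int.cast_add,
    Int.cast_add]
  congr 1
  rw [Int.cast_sum, Int.cast_sum]
  refine Finset.sum_congr rfl fun i _ => ?_
  rw [Int.cast_sum, Int.cast_sum]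
  refine Finset.sum_congr rfl fun j _ => ?_
  push_cast
  generalize ((d (σ i) : ℤ) : ZMod 2) = x
  generalize ((d (σ j) : ℤ) : ZMod 2) = y
  revert x y
  decide

theorem koszul_sum (K : Type*) [Field K] {α : Type*} (s : Finset α) (g : α → ℤ) :
    koszul K (∑ i ∈ s, g i) = ∏ i ∈ s, koszul K (g i) := by
  classical
  induction s using Finset.induction_on with
  | empty => simp [koszul_zero]
  | insert i s hi ih => rw [Finset.sum_insert hi, Finset.prod_insert hi, koszul_add, ih]

/-- The sign of a permutation counts its inversions. -/
theorem sign_eq_koszul (K : Type*) [Field K] {n : ℕ} (σ : Equiv.Perm (Fin n)) :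
    ((Equiv.Perm.sign σ : ℤ) : K) = koszul K (∑ i, ∑ j with i < j ∧ σ j < σ i, 1) := by
  have h : (∑ i, ∑ j with i < j ∧ σ j < σ i, 1 : ℤ) =
      ∑ j, ∑ i ∈ Finset.Iio j, if σ i < σ j then 0 else 1 := by
    simp only [Finset.sum_filter]
    rw [Finset.sum_comm]
    refine Finset.sum_congr rfl fun j _ => ?_
    rw [← Finset.sum_filter, Finset.sum_filter, ← Finset.sum_subset (Finset.subset_univ (Finset.Iio j))]
    · refine Finset.sum_congr rfl fun i hi => ?_
      have hij := Finset.mem_Iio.1 hi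
      rcases lt_trichotomy (σ i) (σ j) with hs | hs | hs
      · simp [hs, hs.not_gt]
      · exact absurd (σ.injective hs) hij.ne
      · simp [hij, hs, hs.not_gt]
    · intro i _ hi
      rw [Finset.mem_Iio] at hi
      simp [hi]
  rw [h, Equiv.Perm.sign_eq_prod_prod_Iio, koszul_sum]
  simp only [koszul_sum]
  push_cast
  refine Finset.prod_congr rfl fun j _ => Finset.prod_congr rfl fun i _ => ?_
  split_ifs <;> simp [koszul_zero, koszul_one]

/-- The sign of the `L_∞` relations, corrected by the décalage signs, is the Koszul sign for the
degrees shifted by one. -/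
theorem permKoszul_add_inversions {n : ℕ} (d : Fin n → ℤ) (σ : Equiv.Perm (Fin n)) :
    ((permKoszul d σ + ∑ i, ∑ j with i < j ∧ σ j < σ i, 1 : ℤ) : ZMod 2) =
      ((decalage (List.ofFn fun i => d (σ i)) + decalage (List.ofFn d) +
        ∑ i, ∑ j with i < j ∧ σ j < σ i, (1 + d (σ i)) * (1 + d (σ j)) : ℤ) : ZMod 2) := by
  have h := decalage_ofFn_comp d σ
  have h1 : ∑ i, ∑ j with i < j ∧ σ j < σ i, (1 + d (σ i)) * (1 + d (σ j)) =
      permKoszul d σ + (∑ i, ∑ j with i < j ∧ σ j < σ i, 1) +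
        ∑ i, ∑ j with i < j ∧ σ j < σ i, (d (σ i) + d (σ j)) := by
    rw [permKoszul, ← Finset.sum_add_distrib, ← Finset.sum_add_distrib]
    refine Finset.sum_congr rfl fun i _ => ?_
    rw [← Finset.sum_add_distrib, ← Finset.sum_add_distrib]
    exact Finset.sum_congr rfl fun j _ => by ring
  rw [h1, Int.cast_add _ (_ + _ + _), Int.cast_add _ (decalage _), h]
  simp only [Int.cast_add]
  generalize ((permKoszul d σ : ℤ) : ZMod 2) = x
  generalize ((∑ i, ∑ j with i < j ∧ σ j < σ i, 1 : ℤ) : ZMod 2) = y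
  generalize ((∑ i, ∑ j with i < j ∧ σ j < σ i, (d (σ i) + d (σ j)) : ℤ) : ZMod 2) = z
  generalize ((decalage (List.ofFn d) : ℤ) : ZMod 2) = w
  revert x y z w
  decide

/-! ### Unshuffles and splittings -/

/-- The splitting of the arguments that is given by the first `s` places of a permutation. -/
def splitOf {n : ℕ} (s : ℕ) (σ : Equiv.Perm (Fin n)) : Fin n → Bool :=
  fun i => decide ((σ.symm i : ℕ) < s)

theorem pairwise_part {n : ℕ} (c : Fin n → Bool) (b : Bool) : (part c b).Pairwise (· < ·) :=
  (List.pairwise_lt_finRange n).filter _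

theorem mem_part {n : ℕ} {c : Fin n → Bool} {b : Bool} {i : Fin n} : i ∈ part c b ↔ c i = b := by
  simp [part]

theorem eq_of_pairwise_lt {n : ℕ} {L M : List (Fin n)} (hL : L.Pairwise (· < ·))
    (hM : M.Pairwise (· < ·)) (h : ∀ i, i ∈ L ↔ i ∈ M) : L = M :=
  hL.eq_of_mem_iff hM h

theorem part_splitOf_true {n s : ℕ} (hs : s ≤ n) {σ : Equiv.Perm (Fin n)} (hσ : IsUnshuffle s σ) :
    part (splitOf s σ) true = List.ofFn fun y : Fin s => σ ⟨y, by omega⟩ := by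
  refine eq_of_pairwise_lt (pairwise_part _ _) ?_ fun i => ?_
  · rw [List.pairwise_ofFn]
    exact fun i j hij => hσ _ _ hij (Or.inl j.2)
  · rw [mem_part, splitOf, decide_eq_true_iff, List.mem_ofFn]
    constructor
    · exact fun h => ⟨⟨_, h⟩, by simp⟩
    · rintro ⟨y, rfl⟩
      simp

theorem part_splitOf_false {n s m : ℕ} (hs : s + m = n) {σ : Equiv.Perm (Fin n)}
    (hσ : IsUnshuffle s σ) :
    part (splitOf s σ) false = List.ofFn fun y : Fin m => σ ⟨s + y, by omega⟩ := by
  refine eq_of_pairwise_lt (pairwise_part _ _) ?_ fun i => ?_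
  · rw [List.pairwise_ofFn]
    exact fun i j hij => hσ _ _ (Nat.add_lt_add_left hij s) (Or.inr (Nat.le_add_right _ _))
  · rw [mem_part, splitOf, decide_eq_false_iff_not, List.mem_ofFn]
    constructor
    · intro h
      refine ⟨⟨(σ.symm i : ℕ) - s, by omega⟩, ?_⟩
      refine (σ.symm_apply_eq.1 (Fin.ext ?_)).symm
      change (σ.symm i : ℕ) = s + ((σ.symm i : ℕ) - s)
      omega
    · rintro ⟨y, rfl⟩
      simp

theorem ofFn_eq_append {n s m : ℕ} (hs : s + m = n) {α : Type*} (g : Fin n → α) :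
    List.ofFn g = (List.ofFn fun y : Fin s => g ⟨y, by omega⟩) ++
      List.ofFn fun y : Fin m => g ⟨s + y, by omega⟩ := by
  subst hs
  rw [List.ofFn_add]
  rfl

theorem ofFn_comp_of_isUnshuffle {n s : ℕ} (hs : s ≤ n) {σ : Equiv.Perm (Fin n)}
    (hσ : IsUnshuffle s σ) :
    List.ofFn σ = part (splitOf s σ) true ++ part (splitOf s σ) false := by
  rw [part_splitOf_true hs hσ, part_splitOf_false (m := n - s) (by omega) hσ,
    ofFn_eq_append (s := s) (m := n - s) (by omega)]

theorem length_part_splitOf {n s : ℕ} (hs : s ≤ n) {σ : Equiv.Perm (Fin n)}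
    (hσ : IsUnshuffle s σ) : (part (splitOf s σ) true).length = s := by
  rw [part_splitOf_true hs hσ, List.length_ofFn]

theorem length_part_add {n : ℕ} (c : Fin n → Bool) :
    (part c true).length + (part c false).length = n := by
  have h := (List.filter_append_perm (fun i => c i == true) (List.finRange n)).length_eq
  rw [List.length_append, List.length_finRange] at h
  refine Eq.trans ?_ h
  rw [part, part]
  congr 3
  funext i
  cases c i <;> rfl

/-- The `(s, n - s)`-unshuffles are the splittings with `s` arguments in the inner bracket. -/
theorem sum_isUnshuffle {M : Type*} [AddCommMonoid M] {n s : ℕ} (hs : s ≤ n)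
    (F : (Fin n → Bool) → M) [DecidablePred fun σ : Equiv.Perm (Fin n) => IsUnshuffle s σ] :
    ∑ σ : Equiv.Perm (Fin n) with IsUnshuffle s σ, F (splitOf s σ) =
      ∑ c : Fin n → Bool with (part c true).length = s, F c := by
  refine Finset.sum_bij (fun σ _ => splitOf s σ) ?_ ?_ ?_ fun _ _ => rfl
  · intro σ hσ
    rw [Finset.mem_filter] at hσ ⊢
    exact ⟨Finset.mem_univ _, length_part_splitOf hs hσ.2⟩
  · intro σ hσ τ hτ h
    have h1 := ofFn_comp_of_isUnshuffle hs (Finset.mem_filter.1 hσ).2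
    have h2 := ofFn_comp_of_isUnshuffle hs (Finset.mem_filter.1 hτ).2
    rw [h, ← h2] at h1
    exact Equiv.ext fun i => congrFun (List.ofFn_injective h1) i
  · intro c hc
    have hc := (Finset.mem_filter.1 hc).2
    set l := part c true ++ part c false with hl
    have hlen : l.length = n := by rw [hl, List.length_append, length_part_add]
    have hnd : l.Nodup := by
      rw [hl, List.nodup_append]
      refine ⟨(pairwise_part _ _).imp fun h => h.ne, (pairwise_part _ _).imp fun h => h.ne, ?_⟩
      intro i hi j hj hij
      rw [mem_part] at hi hj
      rw [hij, hj] at hi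
      exact absurd hi (by decide)
    have hinj : Function.Injective fun i : Fin n => l[(i : ℕ)]'(by omega) := by
      intro i j hij
      exact Fin.ext ((List.Nodup.getElem_inj_iff hnd).1 hij)
    have hlow : ∀ i : Fin n, ∀ hi : (i : ℕ) < s,
        l[(i : ℕ)]'(by omega) = (part c true)[(i : ℕ)]'(by omega) := fun i hi =>
      List.getElem_append_left _
    have hlenf := length_part_add c
    have hhigh : ∀ i : Fin n, ∀ hi : s ≤ (i : ℕ),
        l[(i : ℕ)]'(by omega) = (part c false)[(i : ℕ) - s]'(by omega) := fun i hi => by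
      rw [List.getElem_append_right (by omega)]
      simp only [hc]
    set σ := Equiv.ofBijective _ (Finite.injective_iff_bijective.1 hinj) with hσ
    have hσi : ∀ i : Fin n, σ i = l[(i : ℕ)]'(by omega) := fun i => rfl
    have hun : IsUnshuffle s σ := by
      intro i j hij h
      rw [hσi, hσi]
      have hij' : (i : ℕ) < j := hij
      rcases h with h | h
      · rw [hlow i (by omega), hlow j h]
        exact List.pairwise_iff_getElem.1 (pairwise_part c true) _ _ _ _ hij
      · rw [hhigh i h, hhigh j (by omega)]
        exact List.pairwise_iff_getElem.1 (pairwise_part c false) _ _ _ _ (by omega)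
    refine ⟨σ, Finset.mem_filter.2 ⟨Finset.mem_univ _, hun⟩, funext fun i => ?_⟩
    obtain ⟨j, rfl⟩ := σ.surjective i
    rw [splitOf, Equiv.symm_apply_apply, hσi]
    by_cases hj : (j : ℕ) < s
    · rw [hlow j hj, mem_part.1 (List.getElem_mem (l := part c true) _)]
      simpa using hj
    · rw [hhigh j (by omega), mem_part.1 (List.getElem_mem (l := part c false) _)]
      simpa using hj

/-- The inversions of an unshuffle are the pairs of an inner argument and an outer argument to its
left. -/
theorem sum_inversions_isUnshuffle {n s : ℕ} {σ : Equiv.Perm (Fin n)} (hσ : IsUnshuffle s σ)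
    (d : Fin n → ℤ) :
    ∑ i, ∑ j with i < j ∧ σ j < σ i, (1 + d (σ i)) * (1 + d (σ j)) =
      ∑ j, (if splitOf s σ j = false then 1 + d j else 0) *
        ∑ i with j < i, if splitOf s σ i = true then 1 + d i else 0 := by
  have h1 : ∑ i, ∑ j with i < j ∧ σ j < σ i, (1 + d (σ i)) * (1 + d (σ j)) =
      ∑ i, ∑ j, if σ.symm i < σ.symm j ∧ j < i then (1 + d i) * (1 + d j) else 0 := by
    rw [← Equiv.sum_comp σ fun i => ∑ j, if σ.symm i < σ.symm j ∧ j < i then _ else _]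
    refine Finset.sum_congr rfl fun i _ => ?_
    rw [← Equiv.sum_comp σ fun j => if σ.symm (σ i) < σ.symm j ∧ j < σ i then _ else _,
      Finset.sum_filter]
    simp only [Equiv.symm_apply_apply]
  rw [h1, Finset.sum_comm]
  refine Finset.sum_congr rfl fun j _ => ?_
  rw [Finset.sum_filter, Finset.mul_sum]
  refine Finset.sum_congr rfl fun i _ => ?_
  have hiff : (σ.symm i < σ.symm j ∧ j < i) ↔
      (splitOf s σ j = false ∧ j < i ∧ splitOf s σ i = true) := by
    simp only [splitOf, decide_eq_false_iff_not, decide_eq_true_iff]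
    have hu := hσ (σ.symm i) (σ.symm j)
    have hu' := hσ (σ.symm j) (σ.symm i)
    simp only [Equiv.apply_symm_apply] at hu hu'
    constructor
    · rintro ⟨h1, h2⟩
      have h3 : ¬ ((σ.symm j : ℕ) < s ∨ s ≤ (σ.symm i : ℕ)) := fun h => (hu h1 h).not_gt h2
      omega
    · rintro ⟨h1, h2, h3⟩
      exact ⟨Fin.lt_def.2 (by omega), h2⟩
  rw [if_congr hiff rfl rfl]
  by_cases h1 : splitOf s σ j = false <;> by_cases h2 : j < i <;>
    by_cases h3 : splitOf s σ i = true <;> simp [h1, h2, h3, mul_comm]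

end Unshuffles

section Relation

open GSeries
open Finset.HasAntidiagonal (antidiagonal mem_antidiagonal)

variable {K : Type*} [Field K] {ι : Type*} [Fintype ι] [LinearOrder ι] {δ : ι → ℤ}

/-! ### Weights -/

/-- All terms of `A` have weight at least `w`. -/
def WeightGE (w : ℕ) (A : PolyVec K δ) : Prop := ∀ m, weight m < w → coeff m A = 0

theorem WeightGE.rightDeriv {w : ℕ} {A : PolyVec K δ} (hA : WeightGE (w + 1) A) (a : ι) :
    WeightGE w (GSeries.rightDeriv (Sum.inrₗ a) A) := by
  intro m hm
  rw [coeff_rightDeriv, hA, mul_zero, mul_zero]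
  rw [weight_add, weight_single_inr]
  omega

theorem WeightGE.mul {w : ℕ} {A : PolyVec K δ} (hA : WeightGE w A) (B : PolyVec K δ) :
    WeightGE w (A * B) := by
  intro m hm
  by_cases h : ∀ x, Odd (polyDeg δ x) → m x ≤ 1
  · rw [coeff_mul _ _ _ h]
    refine Finset.sum_eq_zero fun x hx => ?_
    rw [mem_antidiagonal] at hx
    rw [hA, zero_mul, mul_zero]
    rw [← hx, weight_add] at hm
    omega
  · exact coeff_of_not_adm h _

theorem WeightGE.iterBullet {w : ℕ} {A : PolyVec K δ} (L : List (FunctionAlg K δ))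
    (hA : WeightGE (w + L.length) A) : WeightGE w (iterBullet A L) := by
  induction L generalizing w with
  | nil => exact hA
  | cons f L ih =>
    have h := ih (w := w + 1) (by rwa [List.length_cons, ← add_assoc, add_right_comm] at hA)
    intro m hm
    rw [iterBullet_cons, bullet, map_sum]
    exact Finset.sum_eq_zero fun a _ => (h.rightDeriv a).mul _ m hm

theorem setPsiZero_iterBullet_eq_zero {A : PolyVec K δ} {L : List (FunctionAlg K δ)} {w : ℕ}
    (hA : WeightGE w A) (h : L.length < w) : setPsiZero (iterBullet A L) = 0 := by
  have h1 : WeightGE 1 (iterBullet A L) :=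
    WeightGE.iterBullet L fun m hm => hA m (by omega)
  refine ext_coeff fun m => ?_
  rw [coeff_setPsiZero, h1, map_zero]
  rw [weight_embExp]
  exact zero_lt_one

theorem weightGE_of_mem_gV {Γ : PowerSeries (PolyVec K δ)} (hΓ : Γ ∈ gV K δ) (k : ℕ) :
    WeightGE (k + 1) (PowerSeries.coeff k Γ) := by
  intro m hm
  by_cases h : ∀ x, Odd (polyDeg δ x) → m x ≤ 1
  · rw [← hΓ k ⟨m, h⟩ hm]
    exact coeff_val _ ⟨m, h⟩
  · exact coeff_of_not_adm h _

/-! ### The relations of an `L²_∞` algebra as iterated brackets -/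

theorem choose_two_add (a b : ℕ) : (a + b).choose 2 = a.choose 2 + b.choose 2 + a * b := by
  induction b with
  | zero => simp
  | succ b ih =>
    rw [← add_assoc, Nat.choose_succ_succ' (a + b) 1, ih, Nat.choose_succ_succ' b 1,
      Nat.choose_one_right, Nat.choose_one_right]
    ring

/-- The exponent of the overall sign that relates the relation of arity `n` to the iterated
brackets. -/
def relationSign {n : ℕ} (d : Fin n → ℤ) : ℤ :=
  ((n - 1).choose 2 : ℕ) + ((n : ℤ) - 1) + decalage (List.ofFn d)

/-- The sign of a term of a relation, including the signs `(-1)^((n-1)(n-2)/2)` and the décalage signs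
of the two brackets, is an overall sign times the sign of the splitting. -/
theorem relation_sign {n : ℕ} (d : Fin n → ℤ) (x : Fin n) {σ : Equiv.Perm (Fin n)}
    (hσ : IsUnshuffle ((x : ℕ) + 1) σ) :
    let c := splitOf ((x : ℕ) + 1) σ
    koszul K (permKoszul d σ + ((n : ℤ) - x) * x + (∑ i, ∑ j with i < j ∧ σ j < σ i, 1) +
      ((n - 1 - (x : ℕ)).choose 2 +
        decalage ((((part c true).map d).sum + 2 - ((x : ℕ) + 1 : ℕ)) :: (part c false).map d)) +
      ((x : ℕ).choose 2 + decalage ((part c true).map d))) =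
    koszul K (relationSign d + splitSign 0 d c) := by
  intro c
  obtain ⟨m, hm⟩ : ∃ m : ℕ, (x : ℕ) + 1 + m = n := ⟨n - 1 - x, by omega⟩
  have hmx : n - 1 - (x : ℕ) = m := by omega
  have hnx : n - 1 = (x : ℕ) + m := by omega
  have hn : (n : ℤ) = (x : ℕ) + 1 + m := by exact_mod_cast hm.symm
  have hlt : (part c true).length = x + 1 := length_part_splitOf (by omega) hσ
  have hlf : (part c false).length = m := by
    have := length_part_add c
    omega
  have F1 := permKoszul_add_inversions d σ
  have F2 : decalage (List.ofFn fun i => d (σ i)) = decalage ((part c true).map d) +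
      decalage ((part c false).map d) +
      ((x : ℕ) + 1 + ((part c true).map d).sum) * ((part c false).map d).sum := by
    have : (List.ofFn fun i => d (σ i)) = (part c true).map d ++ (part c false).map d := by
      rw [← List.map_append, ← ofFn_comp_of_isUnshuffle (by omega) hσ, List.map_ofFn]
      rfl
    rw [this, decalage_append, List.length_map, hlt]
    push_cast
    ring
  have F3 : splitSign 0 d c = m + ((part c false).map d).sum +
      ∑ i, ∑ j with i < j ∧ σ j < σ i, (1 + d (σ i)) * (1 + d (σ j)) := by
    have h1 : (m : ℤ) + ((part c false).map d).sum = ∑ j, if c j = false then 1 + d j else 0 := by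
      rw [← sum_map_part c false fun i => 1 + d i, List.sum_map_add, List.map_const',
        List.sum_replicate, hlf, nsmul_eq_mul, mul_one]
    rw [sum_inversions_isUnshuffle hσ, h1, splitSign, ← Finset.sum_add_distrib]
    exact Finset.sum_congr rfl fun j _ => by ring
  rw [F2] at F1
  refine koszul_congr K ?_
  rw [F3, relationSign, hmx, hnx, choose_two_add, decalage, hn]
  simp only [Int.cast_add, Int.cast_mul, Int.cast_sub, Int.cast_natCast, Nat.cast_add,
    Nat.cast_mul, Int.cast_one, Int.cast_ofNat, Nat.cast_one] at F1 ⊢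
  generalize ((permKoszul d σ : ℤ) : ZMod 2) = P at *
  generalize ((∑ i, ∑ j with i < j ∧ σ j < σ i, 1 : ℤ) : ZMod 2) = N at *
  obtain rfl : P = _ - N := eq_sub_of_add_eq F1
  generalize ((∑ i, ∑ j with i < j ∧ σ j < σ i, (1 + d (σ i)) * (1 + d (σ j)) : ℤ) : ZMod 2) = I
  generalize ((decalage (List.ofFn d) : ℤ) : ZMod 2) = D
  generalize ((decalage ((part c true).map d) : ℤ) : ZMod 2) = DI
  generalize ((decalage ((part c false).map d) : ℤ) : ZMod 2) = DJ
  generalize ((((part c true).map d).sum : ℤ) : ZMod 2) = S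
  generalize ((((part c false).map d).sum : ℤ) : ZMod 2) = T
  generalize (((x : ℕ).choose 2 : ℕ) : ZMod 2) = u
  generalize ((m.choose 2 : ℕ) : ZMod 2) = v
  generalize (((x : ℕ) : ℕ) : ZMod 2) = x
  generalize ((m : ℕ) : ZMod 2) = m
  have h2 : (2 : ZMod 2) = 0 := rfl
  linear_combination (DI + DJ + T - m + S * T) * h2

/-- One term of a relation, in terms of iterated brackets. -/
theorem relation_term {Γ : PowerSeries (PolyVec K δ)} (hΓ : HasDegree Γ 2) {n : ℕ} {d : Fin n → ℤ}
    {v : Fin n → FunctionAlg K δ} (hv : ∀ i, v i ∈ homog K (coordDeg δ) (d i)) (x : Fin n)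
    {σ : Equiv.Perm (Fin n)} (hσ : IsUnshuffle ((x : ℕ) + 1) σ) (i j : ℕ) :
    koszul K (permKoszul d σ + ((n : ℤ) - x) * x) • ((Equiv.Perm.sign σ : ℤ) : K) •
      bracket Γ i (n - 1 - x + 1) (Fin.cons
        (bracket Γ j (x + 1) fun y : Fin (x + 1) => v (σ ⟨y, by omega⟩))
        (fun y : Fin (n - 1 - x) => v (σ ⟨x + 1 + y, by omega⟩))) =
    koszul K (relationSign d) • koszul K (splitSign 0 d (splitOf ((x : ℕ) + 1) σ)) •
      setPsiZero (iterBullet (PowerSeries.coeff (i - 1) Γ)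
        (setPsiZero (iterBullet (PowerSeries.coeff (j - 1) Γ)
            ((part (splitOf ((x : ℕ) + 1) σ) true).map v)) ::
          (part (splitOf ((x : ℕ) + 1) σ) false).map v)) := by
  have hI := part_splitOf_true (by omega) hσ
  have hJ := part_splitOf_false (m := n - 1 - x) (by omega) hσ
  have hs := relation_sign (K := K) d x hσ
  set c := splitOf ((x : ℕ) + 1) σ
  have hIv : (List.ofFn fun y : Fin ((x : ℕ) + 1) => v (σ ⟨y, by omega⟩)) = (part c true).map v := by
    rw [hI, List.map_ofFn]
    rfl
  have hJv : (List.ofFn fun y : Fin (n - 1 - x) => v (σ ⟨x + 1 + y, by omega⟩)) =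
      (part c false).map v := by
    rw [hJ, List.map_ofFn]
    rfl
  have hId : (List.ofFn fun y : Fin ((x : ℕ) + 1) => d (σ ⟨y, by omega⟩)) = (part c true).map d := by
    rw [hI, List.map_ofFn]
    rfl
  have hJd : (List.ofFn fun y : Fin (n - 1 - x) => d (σ ⟨x + 1 + y, by omega⟩)) =
      (part c false).map d := by
    rw [hJ, List.map_ofFn]
    rfl
  have hinner := bracket_eq_iterBullet hΓ j
    (f := fun y : Fin ((x : ℕ) + 1) => v (σ ⟨y, by omega⟩)) fun y => hv _
  have hdeg := bracket_mem_homog hΓ j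
    (f := fun y : Fin ((x : ℕ) + 1) => v (σ ⟨y, by omega⟩)) fun y => hv _
  rw [← List.sum_ofFn, hId] at hdeg
  rw [hId, hIv] at hinner
  have houter := bracket_eq_iterBullet hΓ i
    (f := Fin.cons (bracket Γ j (x + 1) fun y : Fin (x + 1) => v (σ ⟨y, by omega⟩))
        (fun y : Fin (n - 1 - x) => v (σ ⟨x + 1 + y, by omega⟩)))
    (d := Fin.cons (((part c true).map d).sum + 2 - ((x : ℕ) + 1 : ℕ))
      fun y : Fin (n - 1 - x) => d (σ ⟨x + 1 + y, by omega⟩))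
    (by
      intro y
      refine Fin.cases ?_ (fun y => ?_) y
      · exact hdeg
      · exact hv _)
  rw [List.ofFn_succ, List.ofFn_succ] at houter
  simp only [Fin.cons_zero, Fin.cons_succ] at houter
  rw [hJd, hJv, hinner, iterBullet_cons, map_smul, bullet_smul_right, setPsiZero_smul,
    koszul_smul_smul] at houter
  rw [hinner, houter, sign_eq_koszul, koszul_smul_smul, koszul_smul_smul, koszul_smul_smul, ← hs,
    iterBullet_cons]
  congr 2
  simp only [Nat.add_sub_cancel]
  ring

/-- The splittings of a nested sum, sorted by the number of inner arguments. -/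
theorem nestedSum_eq_sum {Γ : PowerSeries (PolyVec K δ)} (hΓ : Γ ∈ gV K δ) (p q : ℕ) {n : ℕ}
    (d : Fin n → ℤ) (v : Fin n → FunctionAlg K δ) :
    nestedSum (PowerSeries.coeff p Γ) (PowerSeries.coeff q Γ) d v =
      ∑ x : Fin n, ∑ c : Fin n → Bool with (part c true).length = (x : ℕ) + 1,
        koszul K (splitSign 0 d c) • setPsiZero (iterBullet (PowerSeries.coeff p Γ)
          (setPsiZero (iterBullet (PowerSeries.coeff q Γ) ((part c true).map v)) ::
            (part c false).map v)) := by
  rw [nestedSum]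
  simp only [Finset.sum_filter]
  rw [Finset.sum_comm]
  refine Finset.sum_congr rfl fun c _ => ?_
  by_cases h0 : (part c true).length = 0
  · -- The inner bracket without arguments vanishes, because all terms of `Γ` have positive weight.
    have hz : setPsiZero (iterBullet (PowerSeries.coeff q Γ) ((part c true).map v)) = 0 :=
      setPsiZero_iterBullet_eq_zero (weightGE_of_mem_gV hΓ q) (by rw [List.length_map]; omega)
    rw [hz, iterBullet_cons, map_zero]
    simp [bullet, setPsiZero_zero]
  · have hle := length_part_add c
    rw [Finset.sum_eq_single ⟨(part c true).length - 1, by omega⟩]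
    · rw [if_pos]
      change _ = (part c true).length - 1 + 1
      omega
    · intro x _ hx
      rw [if_neg]
      intro h
      refine hx (Fin.ext ?_)
      change (x : ℕ) = (part c true).length - 1
      omega
    · exact fun h => absurd (Finset.mem_univ _) h

/-- The relations of the brackets of `Γ` are nested sums; the coefficient of `ħ^p` belongs to
brackets with index `p + 1`. -/
theorem l2InftyRelation_bracket {Γ : PowerSeries (PolyVec K δ)} (hΓ : HasDegree Γ 2)
    (hV : Γ ∈ gV K δ) {n : ℕ} {d : Fin n → ℤ} {v : Fin n → FunctionAlg K δ}
    (hv : ∀ i, v i ∈ homog K (coordDeg δ) (d i)) (k : ℕ) :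
    l2InftyRelation (bracket Γ) n (k + 2) d v = koszul K (relationSign d) •
      ∑ p ∈ antidiagonal k,
        nestedSum (PowerSeries.coeff p.1 Γ) (PowerSeries.coeff p.2 Γ) d v := by
  classical
  simp only [nestedSum_eq_sum hV]
  rw [Finset.sum_comm, Finset.smul_sum, l2InftyRelation]
  refine Finset.sum_congr rfl fun x _ => ?_
  rw [Finset.smul_sum]
  refine Finset.sum_of_injOn (fun p => (p.1 - 1, p.2 - 1)) ?_ ?_ ?_ ?_
  · rintro ⟨a, b⟩ h ⟨a', b'⟩ h' heq
    simp only [Finset.coe_filter, Set.mem_ofPred_eq, mem_antidiagonal, Prod.mk.injEq] at h h' heq ⊢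
    omega
  · rintro ⟨a, b⟩ h
    simp only [Finset.coe_filter, Set.mem_ofPred_eq, mem_antidiagonal, Finset.mem_coe] at h ⊢
    omega
  · rintro ⟨p, q⟩ h h'
    rw [mem_antidiagonal] at h
    -- The index of one of the brackets exceeds its arity, so the bracket vanishes by the weights of `Γ`.
    have hcase : (x : ℕ) + 1 < q + 1 ∨ n - (x : ℕ) < p + 1 := by
      by_contra hcon
      refine h' ⟨(p + 1, q + 1), ?_, rfl⟩
      simp only [Finset.coe_filter, Set.mem_ofPred_eq, mem_antidiagonal] at h ⊢
      omega
    rw [Finset.sum_eq_zero, smul_zero]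
    intro c hc
    have hl := (Finset.mem_filter.1 hc).2
    have hl' := length_part_add c
    rcases hcase with hcase | hcase
    · have hz : setPsiZero (iterBullet (PowerSeries.coeff q Γ) ((part c true).map v)) = 0 :=
        setPsiZero_iterBullet_eq_zero (weightGE_of_mem_gV hV q) (by rw [List.length_map]; omega)
      rw [hz, iterBullet_cons, map_zero]
      simp [bullet, setPsiZero_zero]
    · rw [setPsiZero_iterBullet_eq_zero (weightGE_of_mem_gV hV p), smul_zero]
      rw [List.length_cons, List.length_map]
      omega
  · rintro ⟨i, j⟩ _
    rw [← sum_isUnshuffle (by omega) fun c => koszul K (splitSign 0 d c) •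
      setPsiZero (iterBullet (PowerSeries.coeff (i - 1) Γ)
        (setPsiZero (iterBullet (PowerSeries.coeff (j - 1) Γ) ((part c true).map v)) ::
          (part c false).map v)), Finset.smul_sum]
    refine Finset.sum_congr (by ext; simp) fun σ hσ => ?_
    exact relation_term hΓ hv x (Finset.mem_filter.1 hσ).2 i j

/-! ### The Schouten square -/

theorem schouten_of_mem_homog {A B : PolyVec K δ} (hA : A ∈ homog K (polyDeg δ) 2)
    (hB : B ∈ homog K (polyDeg δ) 2) : schouten A B = homogBracket 2 2 A B := by
  have h2 : ∀ p : ZMod 2, (((2 : ℤ) : ZMod 2) = p) ↔ p = 0 := by decide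
  have hz : ∀ A : PolyVec K δ, bullet A 0 = 0 := fun A => by simp [bullet]
  rw [schouten, Finset.sum_eq_single 0, Finset.sum_eq_single 0]
  · rw [parityPart_of_mem_homog hA, parityPart_of_mem_homog hB, if_pos ((h2 0).2 rfl), homogBracket]
    congr 2
  · intro q _ hq
    rw [parityPart_of_mem_homog hB q, if_neg (mt (h2 q).1 hq), hz, bullet_zero_left, smul_zero,
      add_zero]
  · exact fun h => absurd (Finset.mem_univ _) h
  · intro p _ hp
    refine Finset.sum_eq_zero fun q _ => ?_
    rw [parityPart_of_mem_homog hA p, if_neg (mt (h2 p).1 hp), hz, bullet_zero_left, smul_zero,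
      add_zero]
  · exact fun h => absurd (Finset.mem_univ _) h

theorem homogBracket_mem_homog {A B : PolyVec K δ} {p q : ℤ} (hA : A ∈ homog K (polyDeg δ) p)
    (hB : B ∈ homog K (polyDeg δ) q) : homogBracket p q A B ∈ homog K (polyDeg δ) (p + q - 1) := by
  refine Submodule.add_mem _ (bullet_mem_homog hA hB) (Submodule.smul_mem _ _ ?_)
  rw [add_comm p q]
  exact bullet_mem_homog hB hA

theorem coeff_schoutenHbar {Γ : PowerSeries (PolyVec K δ)} (hΓ : HasDegree Γ 2) (k : ℕ) :
    PowerSeries.coeff k (schoutenHbar Γ Γ) = ∑ p ∈ antidiagonal k,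
      homogBracket 2 2 (PowerSeries.coeff p.1 Γ) (PowerSeries.coeff p.2 Γ) := by
  rw [schoutenHbar, PowerSeries.coeff_mk]
  exact Finset.sum_congr rfl fun p _ => schouten_of_mem_homog (hΓ _) (hΓ _)

theorem coeff_schoutenHbar_mem_homog {Γ : PowerSeries (PolyVec K δ)} (hΓ : HasDegree Γ 2) (k : ℕ) :
    PowerSeries.coeff k (schoutenHbar Γ Γ) ∈ homog K (polyDeg δ) 3 := by
  rw [coeff_schoutenHbar hΓ]
  exact Submodule.sum_mem _ fun p _ => homogBracket_mem_homog (hΓ _) (hΓ _)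

theorem iterBullet_sum {α : Type*} (s : Finset α) (A : α → PolyVec K δ)
    (L : List (FunctionAlg K δ)) : iterBullet (∑ x ∈ s, A x) L = ∑ x ∈ s, iterBullet (A x) L := by
  classical
  induction s using Finset.induction_on with
  | empty => simp [iterBullet_zero]
  | insert x s hx ih => rw [Finset.sum_insert hx, Finset.sum_insert hx, iterBullet_add, ih]

/-- The multibrackets of `[Γ, Γ]` are twice the left sides of the relations, up to sign. -/
theorem setPsiZero_iterBullet_schoutenHbar {Γ : PowerSeries (PolyVec K δ)} (hΓ : HasDegree Γ 2)
    (hV : Γ ∈ gV K δ) {n : ℕ} {d : Fin n → ℤ} {v : Fin n → FunctionAlg K δ}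
    (hv : ∀ i, v i ∈ homog K (coordDeg δ) (d i)) (k : ℕ) :
    setPsiZero (iterBullet (PowerSeries.coeff k (schoutenHbar Γ Γ)) (List.ofFn v)) =
      (2 : K) • koszul K (relationSign d) • l2InftyRelation (bracket Γ) n (k + 2) d v := by
  have h1 : ∑ p ∈ antidiagonal k,
      nestedSum (PowerSeries.coeff p.2 Γ) (PowerSeries.coeff p.1 Γ) d v =
      ∑ p ∈ antidiagonal k,
        nestedSum (PowerSeries.coeff p.1 Γ) (PowerSeries.coeff p.2 Γ) d v :=
    Finset.Nat.sum_antidiagonal_swap (f := fun p : ℕ × ℕ =>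
      nestedSum (PowerSeries.coeff p.1 Γ) (PowerSeries.coeff p.2 Γ) d v)
  rw [coeff_schoutenHbar hΓ, iterBullet_sum, setPsiZero_sum, l2InftyRelation_bracket hΓ hV hv,
    smul_smul (koszul K _), koszul_mul_self, one_smul, two_smul]
  nth_rewrite 2 [← h1]
  rw [← Finset.sum_add_distrib]
  exact Finset.sum_congr rfl fun p _ =>
    setPsiZero_iterBullet_homogBracket even_two even_two (hΓ _) (hΓ _) hv

end Relation

section Skew

open GSeries

variable {K : Type*} [Field K] {ι : Type*} [Fintype ι] [LinearOrder ι] {δ : ι → ℤ}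

/-! ### Graded skew-symmetry -/

/-- Bracketing with two functions graded-commutes, with respect to the degrees shifted by one. -/
theorem bullet_incl_comm {A : PolyVec K δ} {p d e : ℤ} (hA : A ∈ homog K (polyDeg δ) p)
    {f g : FunctionAlg K δ} (hf : f ∈ homog K (coordDeg δ) d) (hg : g ∈ homog K (coordDeg δ) e) :
    bullet (bullet A (incl f)) (incl g) =
      koszul K ((1 + e) * (1 + d)) • bullet (bullet A (incl g)) (incl f) := by
  have h0 : bullet (incl f : PolyVec K δ) (incl g) = 0 := by
    simp [bullet, rightDeriv_incl]
  have h1 : secondOrder A (incl f) (incl g) d = 0 := by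
    simp [secondOrder, rightDeriv_incl]
  have h2 : bullet A (0 : PolyVec K δ) = 0 := by
    simp [bullet]
  rw [bullet_bullet hA (incl_mem_homog hf) (incl_mem_homog hg) fun a => rightDeriv_incl a g, h0, h1,
    h2, zero_add, sub_zero]

/-- The exponent of the Koszul sign that sorts a list of indices, where `i` has degree `e i`. -/
def sortSign {n : ℕ} (e : Fin n → ℤ) : List (Fin n) → ℤ
  | [] => 0
  | i :: L => (L.map fun j => if j < i then e i * e j else 0).sum + sortSign e L

theorem sortSign_ofFn {n : ℕ} (e : Fin n → ℤ) : ∀ {m : ℕ} (g : Fin m → Fin n),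
    sortSign e (List.ofFn g) = ∑ i, ∑ j with i < j ∧ g j < g i, e (g i) * e (g j)
  | 0, _ => by simp [sortSign]
  | m + 1, g => by
    rw [List.ofFn_succ, sortSign, sortSign_ofFn, List.map_ofFn, List.sum_ofFn]
    simp [Finset.sum_filter, Fin.sum_univ_succ]

theorem iterBullet_perm {A : PolyVec K δ} {p : ℤ} (hA : A ∈ homog K (polyDeg δ) p) {n : ℕ}
    {d : Fin n → ℤ} {f : Fin n → FunctionAlg K δ} (hf : ∀ i, f i ∈ homog K (coordDeg δ) (d i))
    {I I' : List (Fin n)} (h : I.Perm I') :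
    iterBullet A (I.map f) =
      koszul K (sortSign (fun i => 1 + d i) I + sortSign (fun i => 1 + d i) I') •
        iterBullet A (I'.map f) := by
  induction h with
  | nil => simp [sortSign, koszul_zero]
  | @cons i L L' hL ih =>
    rw [List.map_cons, List.map_cons, iterBullet_cons, iterBullet_cons, ih, bullet_smul_left]
    congr 1
    refine koszul_congr K ?_
    rw [sortSign, sortSign, (hL.map _).sum_eq]
    simp only [Int.cast_add]
    generalize (((L'.map fun j => if j < i then (1 + d i) * (1 + d j) else 0).sum : ℤ) : ZMod 2) = x
    generalize ((sortSign (fun i => 1 + d i) L : ℤ) : ZMod 2) = y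
    generalize ((sortSign (fun i => 1 + d i) L' : ℤ) : ZMod 2) = z
    revert x y z
    decide
  | swap i j L =>
    rcases eq_or_ne i j with rfl | hij
    · rw [koszul_of_even K ⟨_, rfl⟩, one_smul]
    · simp only [List.map_cons, iterBullet_cons]
      rw [bullet_incl_comm (iterBullet_mem_homog hA hf L) (hf i) (hf j)]
      congr 1
      refine koszul_congr K ?_
      simp only [sortSign, List.map_cons, List.sum_cons]
      have hlt : ((if i < j then (1 + d j) * (1 + d i) else 0 : ℤ) : ZMod 2) +
          ((if j < i then (1 + d i) * (1 + d j) else 0 : ℤ) : ZMod 2) =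
          (((1 + d j) * (1 + d i) : ℤ) : ZMod 2) := by
        rcases lt_or_gt_of_ne hij with h | h
        · simp [h, h.not_gt]
        · simp [h, h.not_gt, mul_comm]
      rw [← hlt]
      simp only [Int.cast_add]
      generalize ((if i < j then (1 + d j) * (1 + d i) else 0 : ℤ) : ZMod 2) = u
      generalize ((if j < i then (1 + d i) * (1 + d j) else 0 : ℤ) : ZMod 2) = v
      generalize (((L.map fun k => if k < j then (1 + d j) * (1 + d k) else 0).sum : ℤ) :
        ZMod 2) = x
      generalize (((L.map fun k => if k < i then (1 + d i) * (1 + d k) else 0).sum : ℤ) :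
        ZMod 2) = y
      generalize ((sortSign (fun i => 1 + d i) L : ℤ) : ZMod 2) = z
      revert u v x y z
      decide
  | @trans L L' L'' _ _ ih ih' =>
    rw [ih, ih', koszul_smul_smul]
    congr 1
    refine koszul_congr K ?_
    simp only [Int.cast_add]
    generalize ((sortSign (fun i => 1 + d i) L : ℤ) : ZMod 2) = x
    generalize ((sortSign (fun i => 1 + d i) L' : ℤ) : ZMod 2) = y
    generalize ((sortSign (fun i => 1 + d i) L'' : ℤ) : ZMod 2) = z
    revert x y z
    decide

theorem bracket_skew {Γ : PowerSeries (PolyVec K δ)} {p : ℤ} (hΓ : HasDegree Γ p) (k : ℕ)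
    {n : ℕ} {d : Fin n → ℤ} {v : Fin n → FunctionAlg K δ}
    (hv : ∀ i, v i ∈ homog K (coordDeg δ) (d i)) (σ : Equiv.Perm (Fin n)) :
    bracket Γ k n (fun i => v (σ i)) =
      koszul K (permKoszul d σ) • ((Equiv.Perm.sign σ : ℤ) : K) • bracket Γ k n v := by
  have hperm : (List.ofFn σ).Perm (List.ofFn id) := Equiv.Perm.ofFn_comp_perm σ id
  have h1 : (List.ofFn fun i => v (σ i)) = (List.ofFn σ).map v := by
    rw [List.map_ofFn]
    rfl
  have h2 : List.ofFn v = (List.ofFn id).map v := by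
    rw [List.map_ofFn]
    rfl
  have h3 : sortSign (fun i => 1 + d i) (List.ofFn id) = 0 := by
    rw [sortSign_ofFn]
    refine Finset.sum_eq_zero fun i _ => Finset.sum_eq_zero fun j hj => ?_
    have := (Finset.mem_filter.1 hj).2
    exact absurd this.1 this.2.not_gt
  rw [bracket_eq_iterBullet hΓ k hv, bracket_eq_iterBullet hΓ k fun i => hv (σ i), h1,
    iterBullet_perm (hΓ _) hv hperm, ← h2, h3, sortSign_ofFn, setPsiZero_smul, sign_eq_koszul,
    koszul_smul_smul, koszul_smul_smul, koszul_smul_smul]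
  congr 1
  refine koszul_congr K ?_
  have h := permKoszul_add_inversions d σ
  rw [Int.cast_add, Int.cast_add] at h
  simp only [Int.cast_add, Int.cast_zero, Int.cast_natCast] at h ⊢
  revert h
  generalize ((permKoszul d σ : ℤ) : ZMod 2) = P
  generalize ((∑ i, ∑ j with i < j ∧ σ j < σ i, 1 : ℤ) : ZMod 2) = N
  generalize ((∑ i, ∑ j with i < j ∧ σ j < σ i, (1 + d (σ i)) * (1 + d (σ j)) : ℤ) : ZMod 2) = I
  generalize ((decalage (List.ofFn d) : ℤ) : ZMod 2) = D
  generalize ((decalage (List.ofFn fun i => d (σ i)) : ℤ) : ZMod 2) = E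
  generalize (((n - 1).choose 2 : ℕ) : ZMod 2) = u
  revert P N I D E u
  decide

end Skew

section Coordinates

open GSeries

/-! ### Evaluation on the coordinates -/

section

variable {K : Type*} [Field K] {ι : Type*} {δ : ι → ℤ}

open Classical in
/-- The coordinate function `t^a`. -/
noncomputable def coordFun (K : Type*) [Field K] {ι : Type*} (δ : ι → ℤ) (a : ι) :
    FunctionAlg K δ :=
  ⟨fun m => if m.1 = Finsupp.single a 1 then 1 else 0⟩

open Classical in
theorem coeff_coordFun (a : ι) (m : ι →₀ ℕ) :
    coeff m (coordFun K δ a) = if m = Finsupp.single a 1 then 1 else 0 := by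
  by_cases hm : ∀ b, Odd (coordDeg δ b) → m b ≤ 1
  · exact coeff_val (coordFun K δ a) ⟨m, hm⟩
  · rw [coeff_of_not_adm hm, if_neg]
    rintro rfl
    refine hm fun b _ => ?_
    rw [Finsupp.single_apply]
    split_ifs <;> omega

theorem coordFun_mem_homog (a : ι) : coordFun K δ a ∈ homog K (coordDeg δ) (coordDeg δ a) := by
  classical
  rw [mem_homog_iff]
  intro m hm
  rw [coeff_coordFun, if_neg]
  rintro rfl
  exact hm (monDegree_single a)

end

variable {K : Type*} [Field K] {ι : Type*} [Fintype ι] [LinearOrder ι] {δ : ι → ℤ}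

theorem leftDeriv_coordFun (a b : ι) :
    leftDeriv b (coordFun K δ a) = if b = a then 1 else 0 := by
  refine ext_coeff fun ⟨m, hm⟩ => ?_
  change coeff m _ = coeff m _
  rw [coeff_leftDeriv, coeff_coordFun]
  by_cases hba : b = a
  · subst hba
    rw [if_pos rfl, coeff_one]
    by_cases h : m = 0
    · subst h
      simp [koszul_zero]
    · rw [if_neg h, if_neg, mul_zero, mul_zero]
      simpa using h
  · rw [if_neg hba, if_neg, mul_zero, mul_zero, map_zero]
    intro h
    have := DFunLike.congr_fun h b
    simp [Ne.symm hba] at this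

theorem symbolSum_coordFun (A : PolyVec K δ) {n : ℕ} (a : Fin n → ι) (d : Fin n → ℤ) :
    symbolSum A d (fun i => coordFun K δ (a i)) = koszul K (coordSign δ a d) • polyCoeff A a := by
  rw [symbolSum, Finset.sum_eq_single a]
  · simp only [leftDeriv_coordFun, if_true]
    rw [List.ofFn_const, List.prod_replicate, one_pow, mul_one]
  · intro b _ hb
    obtain ⟨i, hi⟩ := Function.ne_iff.1 hb
    rw [List.prod_eq_zero, mul_zero, smul_zero]
    rw [List.mem_ofFn]
    exact ⟨i, by rw [leftDeriv_coordFun, if_neg hi]⟩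
  · exact fun h => absurd (Finset.mem_univ _) h

theorem bracket_coordFun (Γ : PowerSeries (PolyVec K δ)) (k : ℕ) {n : ℕ} (a : Fin n → ι) :
    ∃ c : K, c ≠ 0 ∧ polyCoeff (PowerSeries.coeff (k - 1) Γ) a =
      c • bracket Γ k n fun i => coordFun K δ (a i) := by
  refine ⟨koszul K (coordSign δ a fun i => coordDeg δ (a i)) * koszul K ((n - 1).choose 2),
    mul_ne_zero (koszul_ne_zero K _) (koszul_ne_zero K _), ?_⟩
  rw [bracket_eq_symbolSum Γ k fun i => coordFun_mem_homog (a i), symbolSum_coordFun, smul_smul,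
    mul_assoc, koszul_mul_self, mul_one, smul_smul, koszul_mul_self, one_smul]

omit [LinearOrder ι] in
theorem exists_eq_embExp_add_sum : ∀ {w : ℕ} {m : ι ⊕ₗ ι →₀ ℕ}, weight m = w →
    ∃ (u : ι →₀ ℕ) (L : List ι), L.length = w ∧
      m = embExp u + (L.map fun a => Finsupp.single (Sum.inrₗ a : ι ⊕ₗ ι) (1 : ℕ)).sum
  | 0, m, hm => by
    obtain ⟨u, rfl⟩ := exists_embExp hm
    exact ⟨u, [], rfl, by simp⟩
  | w + 1, m, hm => by
    obtain ⟨a, ha⟩ : ∃ a : ι, m (Sum.inrₗ a) ≠ 0 := by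
      by_contra h
      push Not at h
      rw [weight, Finset.sum_eq_zero fun a _ => h a] at hm
      omega
    have hle : Finsupp.single (Sum.inrₗ a : ι ⊕ₗ ι) 1 ≤ m := by
      rw [Finsupp.single_le_iff]
      omega
    have hm' : m - Finsupp.single (Sum.inrₗ a : ι ⊕ₗ ι) 1 + Finsupp.single (Sum.inrₗ a) 1 = m :=
      tsub_add_cancel_of_le hle
    have hw := congrArg weight hm'
    rw [weight_add, weight_single_inr, hm] at hw
    obtain ⟨u, L, hL, hu⟩ := exists_eq_embExp_add_sum (Nat.add_right_cancel hw)
    refine ⟨u, a :: L, by rw [List.length_cons, hL], ?_⟩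
    rw [List.map_cons, List.sum_cons, ← hm', hu]
    abel

theorem exists_coeff_foldr_rightDeriv [CharZero K] (L : List ι) (m : ι ⊕ₗ ι →₀ ℕ) :
    ∃ c : K, c ≠ 0 ∧ ∀ A : PolyVec K δ,
      coeff m (L.foldr (fun b X => rightDeriv (Sum.inrₗ b) X) A) =
        c * coeff (m + (L.map fun a => Finsupp.single (Sum.inrₗ a : ι ⊕ₗ ι) (1 : ℕ)).sum) A := by
  induction L generalizing m with
  | nil => exact ⟨1, one_ne_zero, fun A => by simp⟩
  | cons b L ih =>
    obtain ⟨c, hc, h⟩ := ih (m + Finsupp.single (Sum.inrₗ b) 1)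
    refine ⟨koszul K (polyDeg δ (Sum.inrₗ b) * ∑ i with Sum.inrₗ b < i, m i * polyDeg δ i) *
      ((m (Sum.inrₗ b) + 1 : K) * c), mul_ne_zero (koszul_ne_zero K _)
        (mul_ne_zero (Nat.cast_add_one_ne_zero _) hc), fun A => ?_⟩
    rw [List.foldr_cons, coeff_rightDeriv, h, List.map_cons, List.sum_cons, add_assoc]
    ring

/-- Every coefficient of a polyvector field is, up to a nonzero factor, a coefficient of one of the
functions `A^{a_1 … a_n}`. -/
theorem exists_coeff_polyCoeff [CharZero K] (m : ι ⊕ₗ ι →₀ ℕ) :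
    ∃ (a : Fin (weight m) → ι) (u : ι →₀ ℕ) (c : K), c ≠ 0 ∧
      monDegree (polyDeg δ) m = monDegree (coordDeg δ) u + ∑ i, (1 - coordDeg δ (a i)) ∧
      ∀ A : PolyVec K δ, coeff u (polyCoeff A a) = c * coeff m A := by
  obtain ⟨u, L, hL, hu⟩ := exists_eq_embExp_add_sum (m := m) rfl
  obtain ⟨c, hc, h⟩ := exists_coeff_foldr_rightDeriv (K := K) (δ := δ) L (embExp u)
  have hofFn : List.ofFn (fun i : Fin (weight m) => L[(i : ℕ)]'(by omega)) = L := by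
    refine List.ext_getElem (by simp [hL]) fun i h1 h2 => by simp
  refine ⟨fun i => L[(i : ℕ)]'(by omega), u, c, hc, ?_, fun A => ?_⟩
  · have hdeg : ∀ L : List ι, monDegree (polyDeg δ)
        (L.map fun a => Finsupp.single (Sum.inrₗ a : ι ⊕ₗ ι) (1 : ℕ)).sum =
        (L.map fun a => 1 - coordDeg δ a).sum := by
      intro L
      induction L with
      | nil => exact monDegree_zero
      | cons a L ih =>
        rw [List.map_cons, List.sum_cons, monDegree_add, ih, monDegree_single, List.map_cons,
          List.sum_cons, polyDeg_inr]
    rw [← List.sum_ofFn]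
    have : (List.ofFn fun i : Fin (weight m) => 1 - coordDeg δ (L[(i : ℕ)]'(by omega))) =
        L.map fun a => 1 - coordDeg δ a := by
      conv_rhs => rw [← hofFn, List.map_ofFn]
      rfl
    rw [this]
    conv_lhs => rw [hu]
    rw [monDegree_add, monDegree_embExp, hdeg]
  · rw [polyCoeff, hofFn, coeff_setPsiZero, h, ← hu]

/-- The degrees of the brackets determine the degree of `Γ`. -/
theorem hasDegree_of_bracket_mem_homog [CharZero K] {Γ : PowerSeries (PolyVec K δ)}
    (hV : Γ ∈ gV K δ) (h : ∀ k n : ℕ, 1 ≤ k → k ≤ n → ∀ a : Fin n → ι,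
      bracket Γ k n (fun i => coordFun K δ (a i)) ∈
        homog K (coordDeg δ) ((∑ i, coordDeg δ (a i)) + 2 - n)) :
    HasDegree Γ 2 := by
  intro k
  rw [mem_homog_iff]
  intro m hm
  by_cases hw : weight m < k + 1
  · exact weightGE_of_mem_gV hV k m hw
  obtain ⟨a, u, c, hc, hdeg, hcoeff⟩ := exists_coeff_polyCoeff (K := K) (δ := δ) m
  -- Terms of weight at least `k + 1` appear in the bracket of index `k + 1` and arity `weight m`.
  obtain ⟨e, -, he⟩ := bracket_coordFun Γ (k + 1) a
  have h0 : coeff u (polyCoeff (PowerSeries.coeff k Γ) a) = 0 := by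
    rw [Nat.add_sub_cancel] at he
    rw [he, map_smul, coeff_eq_zero_of_mem_homog (h (k + 1) _ (by omega) (by omega) a), smul_zero]
    intro hu
    refine hm ?_
    rw [hdeg, hu, Finset.sum_sub_distrib]
    simp
  rw [hcoeff] at h0
  exact (mul_eq_zero.1 h0).resolve_left hc

theorem l2InftyRelation_eq_zero_of_lt {W : Type*} [AddCommGroup W] [Module K W]
    (l : ∀ _ n : ℕ, MultilinearMap K (fun _ : Fin n => W) W) {n k : ℕ} (h : n + 1 < k)
    (d : Fin n → ℤ) (v : Fin n → W) : l2InftyRelation l n k d v = 0 := by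
  refine Finset.sum_eq_zero fun x _ => ?_
  rw [Finset.filter_false_of_mem, Finset.sum_empty]
  rintro ⟨i, j⟩ hij
  rw [Finset.HasAntidiagonal.mem_antidiagonal] at hij
  dsimp only at hij ⊢
  omega

/-- The relations on the coordinates determine `[Γ, Γ]`. -/
theorem schoutenHbar_eq_zero [CharZero K] {Γ : PowerSeries (PolyVec K δ)} (hV : Γ ∈ gV K δ)
    (hΓ : HasDegree Γ 2) (h : ∀ n k : ℕ, 2 ≤ k → k ≤ n + 1 → ∀ a : Fin n → ι,
      l2InftyRelation (bracket Γ) n k (fun i => coordDeg δ (a i))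
        (fun i => coordFun K δ (a i)) = 0) :
    schoutenHbar Γ Γ = 0 := by
  refine PowerSeries.ext fun k => ext_coeff fun ⟨m, _⟩ => ?_
  change coeff m _ = coeff m _
  obtain ⟨a, u, c, hc, -, hcoeff⟩ := exists_coeff_polyCoeff (K := K) (δ := δ) m
  have hv : ∀ i, coordFun K δ (a i) ∈ homog K (coordDeg δ) (coordDeg δ (a i)) :=
    fun i => coordFun_mem_homog (a i)
  have hrel : l2InftyRelation (bracket Γ) (weight m) (k + 2) (fun i => coordDeg δ (a i))
      (fun i => coordFun K δ (a i)) = 0 := by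
    by_cases hk : k + 2 ≤ weight m + 1
    · exact h _ _ (by omega) hk a
    · exact l2InftyRelation_eq_zero_of_lt _ (by omega) _ _
  have h1 := setPsiZero_iterBullet_schoutenHbar hΓ hV hv k
  rw [hrel, smul_zero, smul_zero, setPsiZero_iterBullet (coeff_schoutenHbar_mem_homog hΓ k) hv,
    symbolSum_coordFun, koszul_smul_smul, smul_eq_zero] at h1
  have h2 := hcoeff (PowerSeries.coeff k (schoutenHbar Γ Γ))
  rw [h1.resolve_left (koszul_ne_zero K _), map_zero] at h2
  rw [map_zero, map_zero]
  exact (mul_eq_zero.1 h2.symm).resolve_left hc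

end Coordinates

/-! ### The Leibniz rule and the master equation -/

theorem mainTheorem6 {K : Type*} [Field K] [CharZero K] {ι : Type*} [Fintype ι] [LinearOrder ι]
    (δ : ι → ℤ) (Γ : PowerSeries (PolyVec K δ)) (hΓ : Γ ∈ gV K δ) :
    -- Leibniz rule in the `j`-th argument, with the moved factor on the right
    (∀ (n k : ℕ), 1 ≤ k → k ≤ n →
      ∀ (d : Fin n → ℤ) (f : Fin n → FunctionAlg K δ),
        (∀ i, f i ∈ GSeries.homog K (coordDeg δ) (d i)) →
      ∀ (p q : ℤ), ∀ g ∈ GSeries.homog K (coordDeg δ) p, ∀ h ∈ GSeries.homog K (coordDeg δ) q,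
      ∀ j : Fin n,
        bracket Γ k n (Function.update f j (g * h)) =
          koszul K (p * (q + ∑ i with j < i, d i)) •
              (bracket Γ k n (Function.update f j h) * g) +
            koszul K (q * ∑ i with j < i, d i) •
              (bracket Γ k n (Function.update f j g) * h)) ∧
    -- Leibniz rule in the `j`-th argument, with the moved factor on the left
    (∀ D : ℤ, HasDegree Γ D → ∀ (n k : ℕ), 1 ≤ k → k ≤ n →
      ∀ (d : Fin n → ℤ) (f : Fin n → FunctionAlg K δ),
        (∀ i, f i ∈ GSeries.homog K (coordDeg δ) (d i)) →
      ∀ (p q : ℤ), ∀ g ∈ GSeries.homog K (coordDeg δ) p, ∀ h ∈ GSeries.homog K (coordDeg δ) q,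
      ∀ j : Fin n,
        bracket Γ k n (Function.update f j (g * h)) =
          koszul K (p * (D - n + ∑ i with i < j, d i)) •
              (g * bracket Γ k n (Function.update f j h)) +
            koszul K (q * ∑ i with j < i, d i) •
              (bracket Γ k n (Function.update f j g) * h)) ∧
    (IsL2InftyAlgebra (GSeries.homog K (coordDeg δ)) (bracket Γ) ↔
      HasDegree Γ 2 ∧ schoutenHbar Γ Γ = 0) := by
  refine ⟨fun n k _ _ d f hf p q g hg h hh j => bracket_leibniz Γ k hf hg hh j,
    fun D hD n k _ _ d f hf p q g hg h hh j => bracket_leibniz_left hD k hf hg hh j,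
    fun hL => ?_, fun ⟨hD, hS⟩ => ⟨?_, ?_, ?_⟩⟩
  · have hD : HasDegree Γ 2 := hasDegree_of_bracket_mem_homog hΓ fun k n hk hkn a =>
      hL.degree k n hk hkn _ _ fun i => coordFun_mem_homog (a i)
    exact ⟨hD, schoutenHbar_eq_zero hΓ hD fun n k hk hkn a =>
      hL.relation n k hk hkn _ _ fun i => coordFun_mem_homog (a i)⟩
  · exact fun k n _ _ d v hv => bracket_mem_homog hD k hv
  · exact fun k n _ _ d v hv σ => bracket_skew hD k hv σ
  · intro n k hk _ d v hv
    obtain ⟨k, rfl⟩ := Nat.exists_eq_add_of_le' hk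
    have h := setPsiZero_iterBullet_schoutenHbar hD hΓ hv k
    rw [hS, map_zero, iterBullet_zero, setPsiZero_zero] at h
    exact (smul_eq_zero.1 ((smul_eq_zero.1 h.symm).resolve_left two_ne_zero)).resolve_left
      (koszul_ne_zero K _)
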